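/- **Setting.** Let $\sigma:\mathbb R\to\mathbb R$ be positively $p$-homogeneous with $p>0$, i.e. $\sigma(ct)=c^p\sigma(t)$ for $c>0$, $t\in\mathbb R$. For $\theta=((a_1,w_1),\dots,(a_m,w_m))\in\Theta=(\mathbb R\times\mathbb R^d)^m$ put $f_\theta(x)=\sum_{i=1}^m a_i\sigma(w_i^\top x)$, fix data $X=(x_1,\dots,x_n)\in(\mathbb R^d)^n$, and let $\Phi_X(\theta)=(f_\theta(x_1),\dots,f_\theta(x_n))\in\mathbb R^n$. The group $G=S_m\ltimes(\mathbb R_{>0})^m$ acts on $\Theta$ by permuting neurons and by $(a_i,w_i)\mapsto(c_i^{-p}a_i,c_iw_i)$, and $$T_\theta(G\cdot\theta)=\{((-p\xi_1a_1,\xi_1w_1),\dots,(-p\xi_ma_m,\xi_mw_m)):\xi\in\mathbb R^m\}.$$ Let $\Theta_{\mathrm{reg}}\subset\Theta$ be an open $G$-invariant set on which $G$ acts properly and such that at every $\theta\in\Theta_{\mathrm{reg}}$ the map $\Phi_X$ is smooth, the action is locally free, and $\ker D\Phi_X(\theta)=T_\theta(G\cdot\theta)$. Let $q:\Theta_{\mathrm{reg}}\to\mathcal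 M_{\mathrm{reg}}=\Theta_{\mathrm{reg}}/G$ be the quotient map, $[\theta]=q(\theta)$; $\mathcal M_{\mathrm{reg}}$ carries the smooth manifold structure for which $q$ is a smooth submersion. Let $g_\theta(u,v)=\frac1n\langle D\Phi_X(\theta)u,D\Phi_X(\theta)v\rangle$, and let $\bar g$ be the Riemannian metric on $\mathcal M_{\mathrm{reg}}$ with $\bar g_{[\theta]}(Dq_\theta u,Dq_\theta v)=g_\theta(u,v)$. Let $\widetilde L:\mathbb R^n\to\mathbb R$ be smooth, $\mathcal L=\widetilde L\circ\Phi_X$, and $\bar{\mathcal L}:\mathcal M_{\mathrm{reg}}\to\mathbb R$, $\bar{\mathcal L}([\theta])=\mathcal L(\theta)$. Let $\operatorname{Hess}_{\bar g}\bar{\mathcal L}$ be the Riemannian Hessian (Levi-Civita connection of $\bar g$), and let the effective Hessian $H^{\mathrm{eff}}_{[\theta]}$ be the operator on $T_{[\theta]}\mathcal M_{\mathrm{reg}}$ with $\bar g(H^{\mathrm{eff}}_{[\theta]}\xi,\eta)=\operatorname{Hess}_{\bar g}\bar{\mathcal L}([\theta])(\xi,\eta)$ for all $\xi,\eta$. **Statement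 (nondegeneracy modulo symmetry).** Let $x\in\mathcal M_{\mathrm{reg}}$ be a critical point of $\bar{\mathcal L}$, i.e. $\operatorname{grad}_{\bar g}\bar{\mathcal L}(x)=0$. Then $H^{\mathrm{eff}}_x$ is positive definite, i.e. $\bar g(H^{\mathrm{eff}}_x\xi,\xi)>0$ for all $\xi\ne0$, if and only if $\operatorname{Hess}_{\bar g}\bar{\mathcal L}(x)(\xi,\xi)>0$ for all $\xi\in T_x\mathcal M_{\mathrm{reg}}\setminus\{0\}$. Assume that this holds. Then: 1. $x$ is a nondegenerate strict local minimizer of $\bar{\mathcal L}$ on $\mathcal M_{\mathrm{reg}}$: the bilinear form $\operatorname{Hess}_{\bar g}\bar{\mathcal L}(x)$ is nondegenerate, $H^{\mathrm{eff}}_x$ is invertible, and $\bar{\mathcal L}(y)>\bar{\mathcal L}(x)$ for all $y\neq x$ in a neighborhood of $x$. 2. Every representative $\theta\in\Theta_{\mathrm{reg}}$ of $x$ is a strict local minimizer of $\mathcal L$ modulo its orbit: there is an open neighborhood $U\subset\Theta_{\mathrm{reg}}$ of $\theta$ such that $\mathcal L(\theta')\ge\mathcal L(\theta)$ for all $\theta'\in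 U$, with equality if and only if $\theta'\in G\cdot\theta$. 3. The Euclidean Hessian of $\mathcal L$ at every such $\theta$ is nevertheless degenerate along the orbit directions: $D^2\mathcal L(\theta)[u,v]=0$ for all $u\in T_\theta(G\cdot\theta)$ and all $v\in\Theta$, and $\dim T_\theta(G\cdot\theta)=m$. In particular, for $m\ge1$ degeneracy of the Euclidean Hessian of $\mathcal L$ does not by itself imply degeneracy of $H^{\mathrm{eff}}$ (intrinsic flatness). -/

import Mathlib

open Set Filter Topology
open scoped Manifold ContDiff Matrix

noncomputable section

namespace ShallowNet

/-- An activation `σ : ℝ → ℝ` that is positively `p`-homogeneous with `p > 0`. -/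
structure Activation (p : ℝ) where
  toFun : ℝ → ℝ
  p_pos : 0 < p
  homogeneous : ∀ c t : ℝ, 0 < c → toFun (c * t) = c ^ p * toFun t

/-- Parameters `θ = ((a₁, w₁), …, (aₘ, wₘ)) ∈ (ℝ × ℝᵈ)ᵐ`; `(θ i).1 = aᵢ` and `(θ i).2 = wᵢ`. -/
abbrev Param (m d : ℕ) : Type := Fin m → ℝ × (Fin d → ℝ)

/-- The group of positive reals. -/
abbrev PosReal : Type := {c : ℝ // 0 < c}

/-- The symmetry group `G = Sₘ ⋉ (ℝ_{>0})ᵐ`, where `Sₘ` permutes the coordinates of `(ℝ_{>0})ᵐ`.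
The homogeneity degree `p` does not enter the group, only its action on parameters. -/
def SymGroup (m : ℕ) (_p : ℝ) : Type :=
  (Fin m → PosReal) ⋊[(mulAutArrow : Equiv.Perm (Fin m) →* MulAut (Fin m → PosReal))]
    Equiv.Perm (Fin m)

variable {m d n : ℕ} {p : ℝ}

instance : Group (SymGroup m p) := inferInstanceAs (Group (_ ⋊[_] _))

namespace SymGroup

/-- The scaling part `c` of a group element. -/
def scale (g : SymGroup m p) : Fin m → PosReal := SemidirectProduct.left g

/-- The permutation part `π` of a group element. -/
def perm (g : SymGroup m p) : Equiv.Perm (Fin m) := SemidirectProduct.right g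

def mk (c : Fin m → PosReal) (π : Equiv.Perm (Fin m)) : SymGroup m p := SemidirectProduct.mk c π

@[simp] theorem scale_mk (c : Fin m → PosReal) (π : Equiv.Perm (Fin m)) :
    (mk c π : SymGroup m p).scale = c := rfl
@[simp] theorem perm_mk (c : Fin m → PosReal) (π : Equiv.Perm (Fin m)) :
    (mk c π : SymGroup m p).perm = π := rfl
@[simp] theorem perm_one : (1 : SymGroup m p).perm = 1 := rfl
@[simp] theorem scale_one : (1 : SymGroup m p).scale = 1 := rfl
@[simp] theorem perm_mul (g h : SymGroup m p) : (g * h).perm = g.perm * h.perm := rfl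
theorem scale_mul_apply (g h : SymGroup m p) (i : Fin m) :
    (g * h).scale i = g.scale i * h.scale (g.perm⁻¹ i) := rfl

theorem ext {g h : SymGroup m p} (h₁ : g.scale = h.scale) (h₂ : g.perm = h.perm) : g = h :=
  SemidirectProduct.ext h₁ h₂

end SymGroup

/-- The product topology on `G = Sₘ × (ℝ_{>0})ᵐ`, with `Sₘ` discrete. -/
instance : TopologicalSpace (SymGroup m p) :=
  TopologicalSpace.induced SymGroup.scale inferInstance ⊓
    TopologicalSpace.induced SymGroup.perm ⊥

/-- The action `(c, π) · θ = c · (π · θ)` of `G` on parameters: `π` relabels the neurons, and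
`c` sends `(aᵢ, wᵢ)` to `(cᵢ⁻ᵖ aᵢ, cᵢ wᵢ)`. -/
instance : MulAction (SymGroup m p) (Param m d) where
  smul g θ := fun i =>
    ((g.scale i : ℝ) ^ (-p) * (θ (g.perm⁻¹ i)).1, (g.scale i : ℝ) • (θ (g.perm⁻¹ i)).2)
  one_smul θ := by
    funext i
    change (((1 : ℝ)) ^ (-p) * (θ i).1, (1 : ℝ) • (θ i).2) = θ i
    simp
  mul_smul g h θ := by
    funext i
    change ((((g * h).scale i : PosReal) : ℝ) ^ (-p) * (θ ((g.perm * h.perm)⁻¹ i)).1,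
      (((g * h).scale i : PosReal) : ℝ) • (θ ((g.perm * h.perm)⁻¹ i)).2) =
      ((g.scale i : ℝ) ^ (-p) * ((h.scale (g.perm⁻¹ i) : ℝ) ^ (-p) *
        (θ (h.perm⁻¹ (g.perm⁻¹ i))).1),
        (g.scale i : ℝ) • ((h.scale (g.perm⁻¹ i) : ℝ) • (θ (h.perm⁻¹ (g.perm⁻¹ i))).2))
    rw [SymGroup.scale_mul_apply, mul_inv_rev, Equiv.Perm.mul_apply]
    have hg := (g.scale i).2
    have hh := (h.scale (g.perm⁻¹ i)).2
    simp only [Positive.val_mul, Real.mul_rpow hg.le hh.le, mul_smul, mul_assoc]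

theorem smul_apply (g : SymGroup m p) (θ : Param m d) (i : Fin m) :
    (g • θ) i = ((g.scale i : ℝ) ^ (-p) * (θ (g.perm⁻¹ i)).1,
      (g.scale i : ℝ) • (θ (g.perm⁻¹ i)).2) := rfl

/-- The network `f_θ(x) = ∑ᵢ aᵢ σ(wᵢᵀ x)`. -/
def network (σ : Activation p) (θ : Param m d) (x : Fin d → ℝ) : ℝ :=
  ∑ i, (θ i).1 * σ.toFun ((θ i).2 ⬝ᵥ x)

/-- The finite-sample realization map `Φ_X(θ) = (f_θ(x₁), …, f_θ(xₙ))`. -/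
def realization (σ : Activation p) (X : Fin n → Fin d → ℝ) (θ : Param m d) : Fin n → ℝ :=
  fun k => network σ θ (X k)

/-- `ξ ↦ δ_ξ θ = ((-p ξ₁ a₁, ξ₁ w₁), …, (-p ξₘ aₘ, ξₘ wₘ))`. -/
def orbitVector (p : ℝ) (θ : Param m d) : (Fin m → ℝ) →ₗ[ℝ] Param m d where
  toFun ξ := fun i => (-p * ξ i * (θ i).1, ξ i • (θ i).2)
  map_add' ξ η := by
    funext i
    ext <;> simp <;> ring
  map_smul' c ξ := by
    funext i
    ext <;> simp <;> ring

/-- The orbit tangent space (vertical space) `T_θ(G·θ) = {δ_ξ θ : ξ ∈ ℝᵐ}`. -/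
def orbitTangent (p : ℝ) (θ : Param m d) : Submodule ℝ (Param m d) :=
  LinearMap.range (orbitVector p θ)

/-- Regular points: the realization map is smooth near `θ`, the kernel of its differential is
exactly the orbit tangent space, and the action of `G` is locally free at `θ` (the stabilizer of
`θ` is discrete). -/
structure IsRegularPoint (σ : Activation p) (X : Fin n → Fin d → ℝ) (θ : Param m d) : Prop where
  smooth : ContDiffAt ℝ ∞ (realization σ X) θ
  ker_eq : ∀ u : Param m d, fderiv ℝ (realization σ X) θ u = 0 ↔ u ∈ orbitTangent p θ
  locallyFree : ∀ᶠ g : SymGroup m p in 𝓝 1, g • θ = θ → g = 1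

/-- A regular parameter domain `Θ_reg`: an open `G`-invariant set of regular points on which `G`
acts properly. -/
structure RegularDomain (m : ℕ) (σ : Activation p) (X : Fin n → Fin d → ℝ) where
  /-- The underlying open set of parameters. -/
  carrier : TopologicalSpace.Opens (Param m d)
  smul_mem : ∀ (g : SymGroup m p) (θ : Param m d), θ ∈ carrier → g • θ ∈ carrier
  regular : ∀ θ ∈ carrier, IsRegularPoint σ X θ
  proper : IsProperMap (fun gθ : SymGroup m p × carrier =>
    ((⟨gθ.1 • (gθ.2 : Param m d), smul_mem gθ.1 gθ.2 gθ.2.2⟩, gθ.2) : carrier × carrier))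

variable {σ : Activation p} {X : Fin n → Fin d → ℝ}

namespace RegularDomain

variable (R : RegularDomain m σ X)

instance : MulAction (SymGroup m p) R.carrier where
  smul g θ := ⟨g • (θ : Param m d), R.smul_mem g θ θ.2⟩
  one_smul θ := Subtype.ext (one_smul (SymGroup m p) (θ : Param m d))
  mul_smul g h θ := Subtype.ext (mul_smul g h (θ : Param m d))

@[simp] theorem coe_smul (g : SymGroup m p) (θ : R.carrier) :
    ((g • θ : R.carrier) : Param m d) = g • (θ : Param m d) := rfl

instance : ProperSMul (SymGroup m p) R.carrier := ⟨R.proper⟩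

/-- The quotient `M_reg = Θ_reg / G`, with the quotient topology. -/
def Moduli : Type := MulAction.orbitRel.Quotient (SymGroup m p) R.carrier

instance : TopologicalSpace R.Moduli :=
  inferInstanceAs (TopologicalSpace (Quotient (MulAction.orbitRel (SymGroup m p) R.carrier)))

/-- The quotient map `q : Θ_reg → M_reg`. -/
def proj (θ : R.carrier) : R.Moduli := Quotient.mk (MulAction.orbitRel (SymGroup m p) R.carrier) θ

end RegularDomain

/-- The model space `ℝʳ` of the quotient manifold, `r = dim Θ - m = m d`. -/
abbrev Model (m d : ℕ) : Type := EuclideanSpace ℝ (Fin (m * d))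

namespace RegularDomain

variable (R : RegularDomain m σ X)

/-- Charts of the smooth structure on `M_reg` for which `q : Θ_reg → M_reg` is a smooth
submersion: in the chart `q` is smooth, and it has smooth local sections through every point. -/
structure IsQuotientChart (φ : OpenPartialHomeomorph R.Moduli (Model m d)) : Prop where
  smooth : ∀ θ : R.carrier, R.proj θ ∈ φ.source →
    ContMDiffAt 𝓘(ℝ, Param m d) 𝓘(ℝ, Model m d) ∞ (fun θ' => φ (R.proj θ')) θ
  exists_section : ∀ θ : R.carrier, R.proj θ ∈ φ.source → ∃ s : Model m d → R.carrier,
    s (φ (R.proj θ)) = θ ∧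
    ContMDiffAt 𝓘(ℝ, Model m d) 𝓘(ℝ, Param m d) ∞ s (φ (R.proj θ)) ∧
    ∀ᶠ z in 𝓝 (φ (R.proj θ)), R.proj (s z) = φ.symm z

variable {R}

theorem proj_surjective : Function.Surjective R.proj := fun x => Quotient.exists_rep x

theorem proj_eq_iff {θ θ' : R.carrier} :
    R.proj θ = R.proj θ' ↔ ∃ g : SymGroup m p, g • θ' = θ :=
  Quotient.eq (r := MulAction.orbitRel (SymGroup m p) R.carrier)

theorem proj_smul (g : SymGroup m p) (θ : R.carrier) : R.proj (g • θ) = R.proj θ :=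
  proj_eq_iff.2 ⟨g, rfl⟩

theorem isOpenQuotientMap_proj : IsOpenQuotientMap R.proj :=
  MulAction.isOpenQuotientMap_quotientMk

end RegularDomain

theorem network_smul (σ : Activation p) (g : SymGroup m p) (θ : Param m d) (x : Fin d → ℝ) :
    network σ (g • θ) x = network σ θ x := by
  unfold network
  rw [← Equiv.sum_comp g.perm (fun i => ((g • θ) i).1 * σ.toFun (((g • θ) i).2 ⬝ᵥ x))]
  refine Finset.sum_congr rfl fun i _ => ?_
  have hc := (g.scale (g.perm i)).2
  simp only [smul_apply, Equiv.Perm.inv_def, Equiv.symm_apply_apply, smul_dotProduct, smul_eq_mul]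
  rw [σ.homogeneous _ _ hc, Real.rpow_neg hc.le]
  have := (Real.rpow_pos_of_pos hc p).ne'
  field_simp

theorem realization_smul (σ : Activation p) (X : Fin n → Fin d → ℝ) (g : SymGroup m p)
    (θ : Param m d) : realization σ X (g • θ) = realization σ X θ :=
  funext fun _ => network_smul σ g θ _

/-- The action of a group element as a continuous linear map. -/
def actionL (g : SymGroup m p) : Param m d →L[ℝ] Param m d :=
  LinearMap.toContinuousLinearMap
    { toFun := fun θ => g • θ
      map_add' := fun θ θ' => by
        funext i
        simp only [smul_apply, Pi.add_apply, Prod.fst_add, Prod.snd_add, smul_add, mul_add,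
          Prod.mk_add_mk]
      map_smul' := fun c θ => by
        funext i
        simp only [smul_apply, Pi.smul_apply, Prod.smul_fst, Prod.smul_snd, Prod.smul_mk,
          smul_eq_mul, RingHom.id_apply, mul_left_comm, smul_comm c] }

@[simp] theorem actionL_apply (g : SymGroup m p) (θ : Param m d) : actionL g θ = g • θ := rfl

theorem SymGroup.continuous_scale : Continuous (SymGroup.scale : SymGroup m p → _) :=
  continuous_iff_le_induced.2 (inf_le_left :
    TopologicalSpace.induced SymGroup.scale inferInstance ⊓
      TopologicalSpace.induced (SymGroup.perm : SymGroup m p → _) ⊥ ≤ _)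

theorem SymGroup.isOpen_perm_eq (π : Equiv.Perm (Fin m)) :
    IsOpen {g : SymGroup m p | g.perm = π} := by
  have h : Continuous[_, ⊥] (SymGroup.perm : SymGroup m p → _) :=
    continuous_iff_le_induced.2 (inf_le_right :
      TopologicalSpace.induced SymGroup.scale inferInstance ⊓
        TopologicalSpace.induced (SymGroup.perm : SymGroup m p → _) ⊥ ≤ _)
  let _ : TopologicalSpace (Equiv.Perm (Fin m)) := ⊥
  have _ : DiscreteTopology (Equiv.Perm (Fin m)) := ⟨rfl⟩
  exact (isOpen_discrete {π}).preimage h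

theorem SymGroup.continuous_mk_one {Y : Type*} [TopologicalSpace Y] {f : Y → Fin m → PosReal}
    (hf : Continuous f) : Continuous (fun y => (SymGroup.mk (f y) 1 : SymGroup m p)) := by
  have h : Continuous[_, TopologicalSpace.induced SymGroup.scale inferInstance ⊓
      TopologicalSpace.induced (SymGroup.perm : SymGroup m p → _) ⊥]
      (fun y => (SymGroup.mk (f y) 1 : SymGroup m p)) :=
    continuous_inf_rng.2 ⟨continuous_induced_rng.2 (show Continuous (SymGroup.scale ∘
        fun y => (SymGroup.mk (f y) 1 : SymGroup m p)) from hf),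
      continuous_induced_rng.2 (show Continuous[_, ⊥] (SymGroup.perm ∘
        fun y => (SymGroup.mk (f y) 1 : SymGroup m p)) from @continuous_const _ _ _ ⊥ 1)⟩
  exact h

theorem IsRegularPoint.ne_zero {θ : Param m d} (h : IsRegularPoint σ X θ) (i : Fin m) :
    θ i ≠ 0 := by
  intro hi
  let f : PosReal → Fin m → PosReal := fun t => Function.update 1 i t
  have hf : Continuous f := continuous_const.update i continuous_id
  have h1 : (SymGroup.mk (f 1) 1 : SymGroup m p) = 1 := by
    refine SymGroup.ext ?_ rfl
    simp [f]
  have ht : Tendsto (fun t => (SymGroup.mk (f t) 1 : SymGroup m p)) (𝓝 1) (𝓝 1) := by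
    have := (SymGroup.continuous_mk_one (p := p) hf).tendsto 1
    rwa [h1] at this
  have hev := ht.eventually h.locallyFree
  have hfix : ∀ t, (SymGroup.mk (f t) 1 : SymGroup m p) • θ = θ := by
    intro t
    funext j
    rw [smul_apply]
    by_cases hj : j = i
    · subst hj
      simp [hi]
    · simp [f, hj]
  have hone : ∀ᶠ t : PosReal in 𝓝 1, t = 1 := by
    filter_upwards [hev] with t ht
    have := congrArg (fun g : SymGroup m p => g.scale i) (ht (hfix t))
    simpa [f] using this
  have hlim : Tendsto (fun k : ℕ => (⟨1 + 1 / ((k : ℝ) + 1), by positivity⟩ : PosReal)) atTop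
      (𝓝 1) := by
    rw [tendsto_subtype_rng]
    simpa using tendsto_one_div_add_atTop_nhds_zero_nat.const_add (1 : ℝ)
  obtain ⟨k, hk⟩ := (hlim.eventually hone).exists
  have := congrArg Subtype.val hk
  have h2 : (0 : ℝ) < 1 / ((k : ℝ) + 1) := by positivity
  simp only [Positive.val_one] at this
  linarith

theorem IsRegularPoint.orbitVector_injective {θ : Param m d} (h : IsRegularPoint σ X θ) :
    Function.Injective (orbitVector p θ) := by
  rw [← LinearMap.ker_eq_bot, LinearMap.ker_eq_bot']
  intro ξ hξ
  funext i
  have hi := congrFun hξ i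
  have h1 : -p * ξ i * (θ i).1 = 0 := congrArg Prod.fst hi
  have h2 : ξ i • (θ i).2 = 0 := congrArg Prod.snd hi
  by_contra hne
  have hp := σ.p_pos.ne'
  have hne' : ξ i ≠ 0 := hne
  refine h.ne_zero i (Prod.ext ?_ ?_)
  · simpa [hp, hne'] using h1
  · simpa [hne'] using h2

/-- A group element fixing a regular point is trivial, unless `d = 0`. -/
theorem IsRegularPoint.eq_one_of_smul_eq {θ : Param m d} (h : IsRegularPoint σ X θ) (hd : 0 < d)
    {g : SymGroup m p} (hg : g • θ = θ) : g = 1 := by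
  have hdiff : DifferentiableAt ℝ (realization σ X) θ := h.smooth.differentiableAt (by simp)
  have hinv : (fderiv ℝ (realization σ X) θ).comp (actionL g) = fderiv ℝ (realization σ X) θ := by
    have h1 : HasFDerivAt (realization σ X) (fderiv ℝ (realization σ X) θ) (actionL g θ) := by
      rw [actionL_apply, hg]
      exact hdiff.hasFDerivAt
    have h2 := h1.comp θ (actionL g).hasFDerivAt
    have h3 : (realization σ X) ∘ (actionL g : Param m d → Param m d) = realization σ X := by
      funext θ'
      exact realization_smul σ X g θ'
    rw [h3] at h2
    exact h2.unique hdiff.hasFDerivAt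
  have hmem : ∀ v : Param m d, g • v - v ∈ orbitTangent p θ := by
    intro v
    rw [← h.ker_eq, map_sub, sub_eq_zero]
    exact DFunLike.congr_fun hinv v
  have hperm : g.perm = 1 := by
    by_contra hne
    obtain ⟨j, hj⟩ : ∃ j, g.perm j ≠ j := by
      by_contra! hall
      exact hne (Equiv.ext hall)
    have key : ∀ b : ℝ × (Fin d → ℝ), ∃ t : ℝ, -b = (-p * t * (θ j).1, t • (θ j).2) := by
      intro b
      obtain ⟨ξ, hξ⟩ := hmem (Pi.single j b)
      refine ⟨ξ j, ?_⟩
      have h1 := congrFun hξ j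
      have h2 : g.perm⁻¹ j ≠ j := fun hh => hj (Equiv.Perm.inv_eq_iff_eq.1 hh).symm
      rw [Pi.sub_apply, smul_apply, Pi.single_eq_of_ne h2, Pi.single_eq_same] at h1
      have h3 : (orbitVector p θ ξ) j = (-p * ξ j * (θ j).1, ξ j • (θ j).2) := rfl
      rw [← h3, h1]
      simp [Prod.ext_iff]
    obtain ⟨t, ht⟩ := key (1, 0)
    have ht1 : (-1 : ℝ) = -p * t * (θ j).1 := congrArg Prod.fst ht
    have ht2 : -(0 : Fin d → ℝ) = t • (θ j).2 := congrArg Prod.snd ht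
    have ht0 : t ≠ 0 := by
      rintro rfl
      simp at ht1
    have hw : (θ j).2 = 0 := by
      have : t • (θ j).2 = 0 := by rw [← ht2, neg_zero]
      simpa [ht0] using this
    obtain ⟨s, hs⟩ := key (0, 1)
    have hs2 : -(1 : Fin d → ℝ) = s • (θ j).2 := congrArg Prod.snd hs
    rw [hw, smul_zero] at hs2
    have := congrFun hs2 ⟨0, hd⟩
    simp at this
  refine SymGroup.ext ?_ hperm
  funext i
  have hi := congrFun hg i
  rw [smul_apply, hperm] at hi
  have h1 : (g.scale i : ℝ) ^ (-p) * (θ i).1 = (θ i).1 := congrArg Prod.fst hi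
  have h2 : (g.scale i : ℝ) • (θ i).2 = (θ i).2 := congrArg Prod.snd hi
  have hc := (g.scale i).2
  refine Subtype.ext ?_
  change (g.scale i : ℝ) = 1
  by_cases ha : (θ i).1 = 0
  · have hw : (θ i).2 ≠ 0 := fun hw => h.ne_zero i (Prod.ext ha hw)
    have h3 : ((g.scale i : ℝ) - 1) • (θ i).2 = 0 := by rw [sub_smul, h2, one_smul, sub_self]
    rcases smul_eq_zero.1 h3 with h4 | h4
    · linarith
    · exact absurd h4 hw
  · have h3 : (g.scale i : ℝ) ^ (-p) = 1 := by
      have : ((g.scale i : ℝ) ^ (-p) - 1) * (θ i).1 = 0 := by linarith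
      rcases mul_eq_zero.1 this with h4 | h4
      · linarith
      · exact absurd h4 ha
    have hp := σ.p_pos
    exact (Real.rpow_left_inj hc.le zero_le_one (neg_ne_zero.2 hp.ne')).1 (by rw [h3, Real.one_rpow])

/-- The scaling by `(exp t₁, …, exp tₘ)`. -/
def expScale (p : ℝ) (t : Fin m → ℝ) : SymGroup m p := SymGroup.mk (fun i => ⟨Real.exp (t i), Real.exp_pos _⟩) 1

theorem expScale_smul (t : Fin m → ℝ) (θ : Param m d) (i : Fin m) :
    (expScale p t • θ) i = (Real.exp (-p * t i) * (θ i).1, Real.exp (t i) • (θ i).2) := by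
  have h : Real.exp (t i) ^ (-p) = Real.exp (-p * t i) := by rw [← Real.exp_mul, mul_comm]
  rw [smul_apply]
  simp [expScale, h]

/-- The slice map `(t, h) ↦ exp(t) · (θ + ι h)`. -/
def sliceMap (p : ℝ) (θ : Param m d) (ι : Model m d →L[ℝ] Param m d)
    (y : (Fin m → ℝ) × Model m d) : Param m d := expScale p y.1 • (θ + ι y.2)

theorem contDiff_sliceMap (θ : Param m d) (ι : Model m d →L[ℝ] Param m d) :
    ContDiff ℝ ω (sliceMap p θ ι) := by
  rw [contDiff_pi]
  intro i
  have h1 : ContDiff ℝ ω (fun y : (Fin m → ℝ) × Model m d => y.1 i) :=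
    (contDiff_apply ℝ ℝ i).comp contDiff_fst
  have h2 : ContDiff ℝ ω (fun y : (Fin m → ℝ) × Model m d => (θ + ι y.2) i) :=
    (contDiff_apply ℝ (ℝ × (Fin d → ℝ)) i).comp
      (contDiff_const.add (ι.contDiff.comp contDiff_snd))
  have h3 : (fun y => sliceMap p θ ι y i) = fun y : (Fin m → ℝ) × Model m d =>
      (Real.exp (-p * y.1 i) * ((θ + ι y.2) i).1, Real.exp (y.1 i) • ((θ + ι y.2) i).2) := by
    funext y
    exact expScale_smul _ _ _
  rw [h3]
  exact ((Real.contDiff_exp.comp (contDiff_const.mul h1)).mul (contDiff_fst.comp h2)).prodMk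
    ((Real.contDiff_exp.comp h1).smul (contDiff_snd.comp h2))

theorem hasFDerivAt_sliceMap (θ : Param m d) (ι : Model m d →L[ℝ] Param m d)
    (L : (Fin m → ℝ) × Model m d →L[ℝ] Param m d)
    (hL : ∀ ξ h, L (ξ, h) = orbitVector p θ ξ + ι h) :
    HasFDerivAt (sliceMap p θ ι) L 0 := by
  have hd := ((contDiff_sliceMap (p := p) θ ι).differentiable (by simp) 0).hasFDerivAt
  suffices hLe : L = fderiv ℝ (sliceMap p θ ι) 0 by
    rw [hLe]
    exact hd
  refine ContinuousLinearMap.ext fun v => ?_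
  obtain ⟨ξ, h⟩ := v
  rw [hL]
  have hline : HasDerivAt (fun t : ℝ => sliceMap p θ ι (t • (ξ, h)))
      (fderiv ℝ (sliceMap p θ ι) 0 (ξ, h)) 0 := by
    have h1 : HasDerivAt (fun t : ℝ => t • (ξ, h)) (ξ, h) 0 := by
      simpa using (hasDerivAt_id (0 : ℝ)).smul_const (ξ, h)
    have h2 : HasFDerivAt (sliceMap p θ ι) (fderiv ℝ (sliceMap p θ ι) 0) ((0 : ℝ) • (ξ, h)) := by
      simpa using hd
    exact h2.comp_hasDerivAt 0 h1
  refine HasDerivAt.unique ?_ hline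
  rw [hasDerivAt_pi]
  intro i
  have h3 : (fun t : ℝ => sliceMap p θ ι (t • (ξ, h)) i) = fun t : ℝ =>
      (Real.exp (-p * (t * ξ i)) * ((θ i).1 + t * ((ι h) i).1),
        Real.exp (t * ξ i) • ((θ i).2 + t • ((ι h) i).2)) := by
    funext t
    unfold sliceMap
    rw [expScale_smul]
    simp
  rw [h3]
  have hlin : ∀ c : ℝ, HasDerivAt (fun t : ℝ => t * c) c 0 := fun c => by
    simpa using (hasDerivAt_id (0 : ℝ)).mul_const c
  have ha : HasDerivAt (fun t : ℝ => Real.exp (-p * (t * ξ i)) * ((θ i).1 + t * ((ι h) i).1))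
      (-p * ξ i * (θ i).1 + ((ι h) i).1) 0 := by
    have := (((hlin (ξ i)).const_mul (-p)).exp).fun_mul ((hlin ((ι h) i).1).const_add (θ i).1)
    simpa using this
  have hw : HasDerivAt (fun t : ℝ => Real.exp (t * ξ i) • ((θ i).2 + t • ((ι h) i).2))
      (ξ i • (θ i).2 + ((ι h) i).2) 0 := by
    have h4 : HasDerivAt (fun t : ℝ => (θ i).2 + t • ((ι h) i).2) ((ι h) i).2 0 := by
      simpa using ((hasDerivAt_id (0 : ℝ)).smul_const ((ι h) i).2).const_add (θ i).2
    have := ((hlin (ξ i)).exp).fun_smul h4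
    have h5 : ξ i • (θ i).2 + ((ι h) i).2 = Real.exp ((0 : ℝ) * ξ i) • ((ι h) i).2 +
        (Real.exp ((0 : ℝ) * ξ i) * ξ i) • ((θ i).2 + (0 : ℝ) • ((ι h) i).2) := by
      simp [add_comm]
    rw [h5]
    exact this
  exact ha.prodMk hw

theorem expScale_zero_smul (θ : Param m d) : expScale p (0 : Fin m → ℝ) • θ = θ := by
  funext i
  rw [expScale_smul]
  simp

theorem finrank_param : Module.finrank ℝ (Param m d) = m + m * d := by
  simp [Module.finrank_pi_fintype, Module.finrank_prod]
  ring

theorem IsRegularPoint.finrank_orbitTangent {θ : Param m d} (h : IsRegularPoint σ X θ) :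
    Module.finrank ℝ (orbitTangent p θ) = m := by
  rw [orbitTangent, LinearMap.finrank_range_of_inj h.orbitVector_injective]
  simp

theorem IsRegularPoint.exists_slice {θ : Param m d} (h : IsRegularPoint σ X θ) :
    ∃ (ι : Model m d →L[ℝ] Param m d) (L : ((Fin m → ℝ) × Model m d) ≃L[ℝ] Param m d),
      ∀ ξ z, L (ξ, z) = orbitVector p θ ξ + ι z := by
  obtain ⟨W, hW⟩ := (orbitTangent p θ).exists_isCompl
  have h1 := Submodule.finrank_add_eq_of_isCompl hW
  rw [h.finrank_orbitTangent, finrank_param] at h1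
  have h2 : Module.finrank ℝ (Model m d) = Module.finrank ℝ W := by
    rw [finrank_euclideanSpace_fin]
    omega
  let e : Model m d ≃ₗ[ℝ] W := LinearEquiv.ofFinrankEq _ _ h2
  let ι : Model m d →ₗ[ℝ] Param m d := W.subtype ∘ₗ e.toLinearMap
  let L : ((Fin m → ℝ) × Model m d) →ₗ[ℝ] Param m d := (orbitVector p θ).coprod ι
  have hinj : Function.Injective L := by
    rw [← LinearMap.ker_eq_bot, LinearMap.ker_eq_bot']
    rintro ⟨ξ, z⟩ hz
    have hz' : orbitVector p θ ξ + (e z : Param m d) = 0 := hz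
    have h3 : (e z : Param m d) ∈ orbitTangent p θ :=
      ⟨-ξ, by rw [map_neg]; exact (eq_neg_of_add_eq_zero_right hz').symm⟩
    have h4 : (e z : Param m d) = 0 := Submodule.disjoint_def.1 hW.disjoint _ h3 (e z).2
    have h5 : z = 0 := by simpa using h4
    rw [h4, add_zero] at hz'
    rw [h5, (map_eq_zero_iff _ h.orbitVector_injective).1 hz']
    rfl
  have hfr : Module.finrank ℝ ((Fin m → ℝ) × Model m d) = Module.finrank ℝ (Param m d) := by
    rw [finrank_param, Module.finrank_prod, finrank_euclideanSpace_fin]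
    simp
  exact ⟨LinearMap.toContinuousLinearMap ι,
    (LinearEquiv.ofInjectiveOfFinrankEq L hinj hfr).toContinuousLinearEquiv, fun ξ z => rfl⟩

namespace RegularDomain

variable {R : RegularDomain m σ X}

theorem contMDiffAt_smul (g : SymGroup m p) (θ : R.carrier) :
    ContMDiffAt 𝓘(ℝ, Param m d) 𝓘(ℝ, Param m d) ∞ (fun θ' : R.carrier => g • θ') θ := by
  rw [← ContMDiffAt.subtypeVal_comp_iff]
  exact (actionL g).contDiff.contMDiff.contMDiffAt.comp θ contMDiff_subtype_val.contMDiffAt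

open Classical in
/-- Extend the identity of `Θ_reg` to all parameters by a base point. -/
def retract (θ₀ : R.carrier) (y : Param m d) : R.carrier :=
  if h : y ∈ R.carrier then ⟨y, h⟩ else θ₀

theorem coe_retract (θ₀ : R.carrier) {y : Param m d} (h : y ∈ R.carrier) :
    (retract θ₀ y : Param m d) = y := by simp [retract, h]

theorem contMDiffAt_retract (θ₀ : R.carrier) {y : Param m d} (h : y ∈ R.carrier) :
    ContMDiffAt 𝓘(ℝ, Param m d) 𝓘(ℝ, Param m d) ∞ (retract θ₀) y := by
  rw [← ContMDiffAt.subtypeVal_comp_iff]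
  refine contMDiffAt_id.congr_of_eventuallyEq ?_
  filter_upwards [R.carrier.isOpen.mem_nhds h] with y' hy'
  exact coe_retract θ₀ hy'

theorem exists_nhds_of_proper (hd : 0 < d) (θ₀ : R.carrier) {W : Set (SymGroup m p)}
    (hW : IsOpen W) (h1 : (1 : SymGroup m p) ∈ W) :
    ∃ N ∈ 𝓝 θ₀, ∀ θ ∈ N, ∀ g : SymGroup m p, g • θ ∈ N → g ∈ W := by
  have hcl : IsClosed ((fun gx : SymGroup m p × R.carrier => (gx.1 • gx.2, gx.2)) ''
      (Wᶜ ×ˢ univ)) :=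
    (ProperSMul.isProperMap_smul_pair (G := SymGroup m p) (X := R.carrier)).isClosedMap _
      (hW.isClosed_compl.prod isClosed_univ)
  have hnot : (θ₀, θ₀) ∉ (fun gx : SymGroup m p × R.carrier => (gx.1 • gx.2, gx.2)) ''
      (Wᶜ ×ˢ univ) := by
    rintro ⟨⟨g, θ⟩, ⟨hg, -⟩, hgθ⟩
    have h2 : θ = θ₀ := congrArg Prod.snd hgθ
    have h3 : g • θ = θ₀ := congrArg Prod.fst hgθ
    subst h2
    have h4 : g • (θ : Param m d) = θ := congrArg Subtype.val h3
    have := (R.regular θ θ.2).eq_one_of_smul_eq hd h4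
    exact hg (this ▸ h1)
  have hn := hcl.isOpen_compl.mem_nhds hnot
  rw [nhds_prod_eq, Filter.mem_prod_self_iff] at hn
  obtain ⟨N, hN, hNs⟩ := hn
  refine ⟨N, hN, fun θ hθ g hg => ?_⟩
  by_contra hgW
  exact hNs (mk_mem_prod hg hθ) ⟨(g, θ), ⟨hgW, mem_univ _⟩, rfl⟩

/-- Around every point of `M_reg` there is a chart of the quotient structure. -/
theorem exists_quotientChart (R : RegularDomain m σ X) (x : R.Moduli) :
    ∃ φ : OpenPartialHomeomorph R.Moduli (Model m d), x ∈ φ.source ∧ R.IsQuotientChart φ := by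
  obtain ⟨θ₀, rfl⟩ := proj_surjective x
  obtain ⟨ι, L, hL⟩ := (R.regular θ₀ θ₀.2).exists_slice
  let F := sliceMap p (θ₀ : Param m d) ι
  have hF0 : F 0 = θ₀ := by
    change expScale p 0 • ((θ₀ : Param m d) + ι 0) = _
    rw [expScale_zero_smul, map_zero, add_zero]
  have hFe : ∀ t z, F (t, z) = expScale p t • ((θ₀ : Param m d) + ι z) := fun _ _ => rfl
  have hFc : ContDiff ℝ ω F := contDiff_sliceMap _ _
  have hFd : HasFDerivAt F (L : (Fin m → ℝ) × Model m d →L[ℝ] Param m d) 0 :=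
    hasFDerivAt_sliceMap _ _ _ hL
  let e := hFc.contDiffAt.toOpenPartialHomeomorph F hFd (by simp)
  have he : ∀ y, e y = F y := fun _ => rfl
  have he0 : (0 : (Fin m → ℝ) × Model m d) ∈ e.source :=
    hFc.contDiffAt.mem_toOpenPartialHomeomorph_source hFd (by simp)
  have hsymm0 : ContDiffAt ℝ ω e.symm (θ₀ : Param m d) := by
    have ht : (θ₀ : Param m d) ∈ e.target := by
      rw [← hF0]
      exact e.map_source he0
    have hs : e.symm θ₀ = 0 := by
      rw [← hF0]
      exact e.left_inv he0
    refine e.contDiffAt_symm ht (f₀' := L) ?_ ?_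
    · rw [hs]
      exact hFd
    · rw [hs]
      exact hFc.contDiffAt
  have hsymm : ∀ᶠ y in 𝓝 (θ₀ : Param m d), ContDiffAt ℝ ω e.symm y :=
    hsymm0.eventually (by simp)
  -- a product neighbourhood of `0` in the source
  obtain ⟨T, hT, B₀, hB₀, hTB⟩ := mem_nhds_prod_iff.1 (e.open_source.mem_nhds he0)
  obtain ⟨T', hT'T, hT'o, hT'0⟩ := mem_nhds_iff.1 hT
  -- a neighbourhood of the identity in the group
  let lg : SymGroup m p → Fin m → ℝ := fun g i => Real.log (g.scale i : ℝ)
  have hlg : Continuous lg := by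
    refine continuous_pi fun i => ?_
    have h1 : Continuous fun g : SymGroup m p => (g.scale i : ℝ) :=
      continuous_subtype_val.comp ((continuous_apply i).comp SymGroup.continuous_scale)
    exact h1.log fun g => (g.scale i).2.ne'
  let W : Set (SymGroup m p) := {g | g.perm = 1} ∩ lg ⁻¹' T'
  have hWo : IsOpen W := (SymGroup.isOpen_perm_eq 1).inter (hT'o.preimage hlg)
  have hW1 : (1 : SymGroup m p) ∈ W := by
    refine ⟨rfl, ?_⟩
    have : lg 1 = 0 := by
      funext i
      simp [lg]
    change lg 1 ∈ T'
    rw [this]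
    exact hT'0
  have hWexp : ∀ g ∈ W, g = expScale p (lg g) := by
    rintro g ⟨hg, -⟩
    refine SymGroup.ext ?_ hg
    funext i
    refine Subtype.ext ?_
    exact (Real.exp_log (g.scale i).2).symm
  have hN : ∃ N ∈ 𝓝 θ₀, 0 < d → ∀ θ ∈ N, ∀ g : SymGroup m p, g • θ ∈ N → g ∈ W := by
    by_cases hd : 0 < d
    · obtain ⟨N, hN, h⟩ := exists_nhds_of_proper hd θ₀ hWo hW1
      exact ⟨N, hN, fun _ => h⟩
    · exact ⟨univ, univ_mem, fun h => absurd h hd⟩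
  obtain ⟨N, hN, hNW⟩ := hN
  -- the slice
  let s : Model m d → R.carrier := fun z => retract θ₀ ((θ₀ : Param m d) + ι z)
  have hlin : ContDiff ℝ ∞ (fun z : Model m d => (θ₀ : Param m d) + ι z) :=
    contDiff_const.add ι.contDiff
  have hlin0 : (θ₀ : Param m d) + ι 0 = θ₀ := by simp
  have hlint : Tendsto (fun z : Model m d => (θ₀ : Param m d) + ι z) (𝓝 0)
      (𝓝 (θ₀ : Param m d)) := by
    have := hlin.continuous.tendsto 0
    rwa [hlin0] at this
  have hs0 : s 0 = θ₀ := Subtype.ext (by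
    change ((retract θ₀ ((θ₀ : Param m d) + ι 0) : R.carrier) : Param m d) = θ₀
    rw [hlin0, coe_retract θ₀ θ₀.2])
  have hR0 : ∀ᶠ z in 𝓝 (0 : Model m d), (θ₀ : Param m d) + ι z ∈ R.carrier :=
    hlint.eventually (R.carrier.isOpen.mem_nhds θ₀.2)
  have hs_smooth : ∀ z, (θ₀ : Param m d) + ι z ∈ R.carrier →
      ContMDiffAt 𝓘(ℝ, Model m d) 𝓘(ℝ, Param m d) ∞ s z := fun z hz =>
    (contMDiffAt_retract θ₀ hz).comp z hlin.contMDiff.contMDiffAt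
  have hst : Tendsto s (𝓝 0) (𝓝 θ₀) := by
    have := (hs_smooth 0 (by rw [hlin0]; exact θ₀.2)).continuousAt.tendsto
    rwa [hs0] at this
  have hgood : ∀ᶠ z in 𝓝 (0 : Model m d), (z ∈ B₀ ∧ (θ₀ : Param m d) + ι z ∈ R.carrier ∧
      s z ∈ N ∧ ContDiffAt ℝ ω e.symm ((θ₀ : Param m d) + ι z)) :=
    (eventually_mem_set.2 hB₀).and (hR0.and ((hst.eventually hN).and (hlint.eventually hsymm)))
  obtain ⟨B, hBgood, hBo, hB0⟩ := mem_nhds_iff.1 hgood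
  have hsB : ∀ z ∈ B, (s z : Param m d) = (θ₀ : Param m d) + ι z := fun z hz =>
    coe_retract θ₀ (hBgood hz).2.1
  have hsource : ∀ t ∈ T', ∀ z ∈ B, (t, z) ∈ e.source := fun t ht z hz =>
    hTB (mk_mem_prod (hT'T ht) (hBgood hz).1)
  let ψ : Model m d → R.Moduli := fun z => R.proj (s z)
  have hψinj : InjOn ψ B := by
    intro z hz z' hz' hzz
    by_cases hd : 0 < d
    · obtain ⟨g, hg⟩ := proj_eq_iff.1 hzz
      have hgW : g ∈ W := hNW hd (s z') (hBgood hz').2.2.1 g (by rw [hg]; exact (hBgood hz).2.2.1)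
      have h1 : g • (s z' : Param m d) = s z := congrArg Subtype.val hg
      rw [hsB z hz, hsB z' hz', hWexp g hgW] at h1
      have h2 : e (lg g, z') = e (0, z) := by
        rw [he, he, hFe, hFe, h1, expScale_zero_smul]
      have h3 := e.injOn (hsource _ hgW.2 _ hz') (hsource _ hT'0 _ hz) h2
      exact (congrArg Prod.snd h3).symm
    · have hd0 : d = 0 := by omega
      subst hd0
      have : IsEmpty (Fin (m * 0)) := by
        rw [mul_zero]
        infer_instance
      exact Subsingleton.elim z z'
  have hψcont : ContinuousOn ψ B := fun z hz =>
    (isOpenQuotientMap_proj.continuous.continuousAt.comp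
      (hs_smooth z (hBgood hz).2.1).continuousAt).continuousWithinAt
  -- on the image of the slice map, the projection only depends on the slice coordinate
  have hprojF : ∀ t, ∀ z ∈ B, ∀ θ : R.carrier, (θ : Param m d) = F (t, z) → R.proj θ = ψ z := by
    intro t z hz θ hθ
    refine proj_eq_iff.2 ⟨expScale p t, Subtype.ext ?_⟩
    rw [coe_smul, hsB z hz, hθ, hFe]
  have hψopen : ∀ O ⊆ B, IsOpen O → IsOpen (ψ '' O) := by
    intro O hOB hO
    have h1 : IsOpen (e '' (T' ×ˢ O)) :=
      e.isOpen_image_of_subset_source (hT'o.prod hO)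
        (fun y hy => hsource _ hy.1 _ (hOB hy.2))
    have h2 : IsOpen ((Subtype.val : R.carrier → Param m d) ⁻¹' (e '' (T' ×ˢ O))) :=
      h1.preimage continuous_subtype_val
    have h3 := isOpenQuotientMap_proj.isOpenMap _ h2
    convert h3 using 1
    ext x
    constructor
    · rintro ⟨z, hz, rfl⟩
      refine ⟨s z, ⟨(0, z), ⟨hT'0, hz⟩, ?_⟩, rfl⟩
      rw [he, hFe, hsB z (hOB hz), expScale_zero_smul]
    · rintro ⟨θ, ⟨⟨t, z⟩, ⟨ht, hz⟩, hθ⟩, rfl⟩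
      exact ⟨z, hz, (hprojF t z (hOB hz) θ hθ.symm).symm⟩
  let pe : PartialEquiv (Model m d) R.Moduli := hψinj.toPartialEquiv
  have hpe_source : pe.source = B := rfl
  have hpe : ∀ z, pe z = ψ z := fun _ => rfl
  have ho : IsOpenMap (pe.source.domRestrict pe) := by
    intro O hO
    obtain ⟨O', hO', rfl⟩ := isOpen_induced_iff.1 hO
    have : (pe.source.domRestrict pe) '' (Subtype.val ⁻¹' O') = ψ '' (O' ∩ B) := by
      ext x
      constructor
      · rintro ⟨⟨z, hz⟩, hzO, rfl⟩
        exact ⟨z, ⟨hzO, hz⟩, rfl⟩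
      · rintro ⟨z, ⟨hzO, hz⟩, rfl⟩
        exact ⟨⟨z, hz⟩, hzO, rfl⟩
    rw [this]
    exact hψopen _ inter_subset_right (hO'.inter hBo)
  let φ' : OpenPartialHomeomorph (Model m d) R.Moduli :=
    OpenPartialHomeomorph.ofContinuousOpenRestrict pe hψcont ho hBo
  have hφ'B : φ'.source = B := rfl
  have hφ' : ∀ z, φ' z = ψ z := fun _ => rfl
  refine ⟨φ'.symm, ?_, ?_, ?_⟩
  · have : φ' 0 ∈ φ'.target := φ'.map_source hB0
    rw [hφ'] at this
    simp only [ψ, hs0] at this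
    exact this
  · intro θ hθ
    have hzB : φ'.symm (R.proj θ) ∈ B := φ'.map_target hθ
    set z := φ'.symm (R.proj θ) with hz
    have h1 : ψ z = R.proj θ := φ'.right_inv hθ
    obtain ⟨g, hg⟩ := proj_eq_iff.1 h1
    have hg' : g • (θ : Param m d) = (θ₀ : Param m d) + ι z := by
      rw [← coe_smul, hg, hsB z hzB]
    have hF : (θ₀ : Param m d) + ι z = e (0, z) := by
      rw [he, hFe, expScale_zero_smul]
    have hcs : ContDiffAt ℝ ω e.symm (g • (θ : Param m d)) := by
      rw [hg']
      exact (hBgood hzB).2.2.2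
    have hes : e.symm (g • (θ : Param m d)) = (0, z) := by
      rw [hg', hF, e.left_inv (hsource _ hT'0 _ hzB)]
    have hsm : ContDiffAt ℝ ω (fun y : Param m d => (e.symm (g • y)).2) (θ : Param m d) :=
      (contDiff_snd.contDiffAt (x := e.symm (g • (θ : Param m d)))).comp (θ : Param m d)
        (ContDiffAt.comp (θ : Param m d) (g := e.symm) (f := fun y => actionL g y) hcs
          (actionL g).contDiff.contDiffAt)
    have hsm' : ContMDiffAt 𝓘(ℝ, Param m d) 𝓘(ℝ, Model m d) ∞
        (fun θ' : R.carrier => (e.symm (g • (θ' : Param m d))).2) θ :=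
      contMDiffAt_subtype_iff.2 (hsm.of_le le_top).contMDiffAt
    refine hsm'.congr_of_eventuallyEq ?_
    have hcont : ContinuousAt (fun θ' : R.carrier => g • (θ' : Param m d)) θ :=
      ((actionL g).continuous.comp continuous_subtype_val).continuousAt
    have ht : g • (θ : Param m d) ∈ e.target := by
      rw [hg', hF]
      exact e.map_source (hsource _ hT'0 _ hzB)
    have hev1 : ∀ᶠ θ' : R.carrier in 𝓝 θ, g • (θ' : Param m d) ∈ e.target :=
      hcont.eventually (e.open_target.mem_nhds ht)
    have hev2 : ∀ᶠ θ' : R.carrier in 𝓝 θ, (e.symm (g • (θ' : Param m d))).2 ∈ B := by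
      have : ContinuousAt (fun θ' : R.carrier => (e.symm (g • (θ' : Param m d))).2) θ :=
        hsm'.continuousAt
      refine this.eventually (hBo.mem_nhds ?_)
      change (e.symm (g • (θ : Param m d))).2 ∈ B
      rw [hes]
      exact hzB
    filter_upwards [hev1, hev2] with θ' h1' h2'
    have h3 : R.proj (g • θ') = ψ (e.symm (g • (θ' : Param m d))).2 :=
      hprojF (e.symm (g • (θ' : Param m d))).1 _ h2' (g • θ') (by
        rw [coe_smul, ← he]
        exact (e.right_inv h1').symm)
    rw [proj_smul] at h3
    rw [h3]
    exact φ'.left_inv h2'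
  · intro θ hθ
    have hzB : φ'.symm (R.proj θ) ∈ B := φ'.map_target hθ
    set z := φ'.symm (R.proj θ) with hz
    have h1 : ψ z = R.proj θ := φ'.right_inv hθ
    obtain ⟨g, hg⟩ := proj_eq_iff.1 h1.symm
    refine ⟨fun z' => g • s z', hg, ?_, ?_⟩
    · exact (contMDiffAt_smul g (s z)).comp z (hs_smooth z (hBgood hzB).2.1)
    · exact Eventually.of_forall fun z' => proj_smul g (s z')

end RegularDomain

namespace RegularDomain

variable (R : RegularDomain m σ X)

/-- The smooth atlas of `M_reg`: all charts compatible with `q` being a smooth submersion. -/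
instance : ChartedSpace (Model m d) R.Moduli where
  atlas := {φ | R.IsQuotientChart φ}
  chartAt x := Classical.choose (R.exists_quotientChart x)
  mem_chart_source x := (Classical.choose_spec (R.exists_quotientChart x)).1
  chart_mem_atlas x := (Classical.choose_spec (R.exists_quotientChart x)).2

/-- `M_reg` is a smooth manifold. -/
instance : IsManifold 𝓘(ℝ, Model m d) ∞ R.Moduli := by
  refine isManifold_of_contDiffOn _ _ _ fun φ ψ hφ hψ => ?_
  have hφ' : R.IsQuotientChart φ := hφ
  have hψ' : R.IsQuotientChart ψ := hψ
  intro z hz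
  have hz1 : z ∈ (φ.symm ≫ₕ ψ).source := hz.1
  rw [OpenPartialHomeomorph.trans_source] at hz1
  have hzt : z ∈ φ.target := hz1.1
  have hzs : φ.symm z ∈ ψ.source := hz1.2
  obtain ⟨θ, hθ⟩ := proj_surjective (φ.symm z)
  have hφz : φ (R.proj θ) = z := by rw [hθ, φ.right_inv hzt]
  obtain ⟨s, hs1, hs2, hs3⟩ := hφ'.exists_section θ (by rw [hθ]; exact φ.map_target hzt)
  rw [hφz] at hs1 hs2 hs3
  have h1 : ContMDiffAt 𝓘(ℝ, Param m d) 𝓘(ℝ, Model m d) ∞ (fun θ' => ψ (R.proj θ')) (s z) := by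
    rw [hs1]
    exact hψ'.smooth θ (by rw [hθ]; exact hzs)
  have h2 : ContDiffAt ℝ ∞ (fun z' => ψ (R.proj (s z'))) z := (h1.comp z hs2).contDiffAt
  refine ContDiffAt.contDiffWithinAt (h2.congr_of_eventuallyEq ?_)
  filter_upwards [hs3] with z' hz'
  rw [hz']
  rfl

instance : T2Space R.Moduli :=
  t2Space_quotient_mulAction_of_properSMul (G := SymGroup m p) (X := R.carrier)

instance : SecondCountableTopology R.Moduli :=
  ContinuousConstSMul.secondCountableTopology (Γ := SymGroup m p) (T := R.carrier)

variable {R}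

theorem isQuotientChart_chartAt (x : R.Moduli) : R.IsQuotientChart (chartAt (Model m d) x) :=
  (Classical.choose_spec (R.exists_quotientChart x)).2

theorem contMDiffAt_proj (θ : R.carrier) :
    ContMDiffAt 𝓘(ℝ, Param m d) 𝓘(ℝ, Model m d) ∞ R.proj θ := by
  rw [contMDiffAt_iff_target]
  exact ⟨isOpenQuotientMap_proj.continuous.continuousAt,
    (isQuotientChart_chartAt (R.proj θ)).smooth θ (mem_chart_source _ _)⟩

/-- `q` has smooth local sections through every point. -/
theorem exists_local_section (θ : R.carrier) : ∃ s : R.Moduli → R.carrier,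
    s (R.proj θ) = θ ∧ ContMDiffAt 𝓘(ℝ, Model m d) 𝓘(ℝ, Param m d) ∞ s (R.proj θ) ∧
      ∀ᶠ x in 𝓝 (R.proj θ), R.proj (s x) = x := by
  obtain ⟨s, hs1, hs2, hs3⟩ := (isQuotientChart_chartAt (R.proj θ)).exists_section θ
    (mem_chart_source _ _)
  refine ⟨fun x => s (chartAt (Model m d) (R.proj θ) x), hs1, ?_, ?_⟩
  · exact ContMDiffAt.comp (R.proj θ) hs2 contMDiffAt_extChartAt
  · have hc : ContinuousAt (chartAt (Model m d) (R.proj θ)) (R.proj θ) :=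
      (chartAt (Model m d) (R.proj θ)).continuousAt (mem_chart_source _ _)
    filter_upwards [hc.eventually hs3,
      (chartAt (Model m d) (R.proj θ)).open_source.mem_nhds (mem_chart_source _ _)] with x h1 h2
    rw [h1]
    exact (chartAt (Model m d) (R.proj θ)).left_inv h2

/-- The tangent space `T_x M_reg`. -/
abbrev Tan (x : R.Moduli) : Type := TangentSpace 𝓘(ℝ, Model m d) x

instance (x : R.Moduli) : FiniteDimensional ℝ (Tan x) :=
  inferInstanceAs (FiniteDimensional ℝ (Model m d))

theorem finrank_tan (x : R.Moduli) : Module.finrank ℝ (Tan x) = m * d := by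
  change Module.finrank ℝ (Model m d) = m * d
  rw [finrank_euclideanSpace_fin]

/-- The differential `Dq_θ : T_θ Θ_reg → T_{[θ]} M_reg`; as `Θ_reg` is open in the vector space
`Θ`, `T_θ Θ_reg = Θ`. -/
def projDeriv (θ : R.carrier) : Param m d →L[ℝ] Tan (R.proj θ) :=
  mfderiv 𝓘(ℝ, Param m d) 𝓘(ℝ, Model m d) R.proj θ

theorem projDeriv_surjective (θ : R.carrier) : Function.Surjective (projDeriv θ) := by
  obtain ⟨s, hs1, hs2, hs3⟩ := exists_local_section θ
  have h1 : MDifferentiableAt 𝓘(ℝ, Model m d) 𝓘(ℝ, Param m d) s (R.proj θ) :=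
    hs2.mdifferentiableAt (by simp)
  have h2 : MDifferentiableAt 𝓘(ℝ, Param m d) 𝓘(ℝ, Model m d) R.proj (s (R.proj θ)) :=
    (contMDiffAt_proj _).mdifferentiableAt (by simp)
  have h3 := mfderiv_comp (R.proj θ) h2 h1
  have h4 : mfderiv 𝓘(ℝ, Model m d) 𝓘(ℝ, Model m d) (R.proj ∘ s) (R.proj θ) =
      mfderiv 𝓘(ℝ, Model m d) 𝓘(ℝ, Model m d) id (R.proj θ) :=
    Filter.EventuallyEq.mfderiv_eq hs3
  rw [mfderiv_id] at h4
  intro ξ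
  refine ⟨mfderiv 𝓘(ℝ, Model m d) 𝓘(ℝ, Param m d) s (R.proj θ) ξ, ?_⟩
  have h5 : mfderiv 𝓘(ℝ, Model m d) 𝓘(ℝ, Model m d) (R.proj ∘ s) (R.proj θ) ξ = ξ := by
    rw [h4]
    rfl
  rw [h3, hs1] at h5
  exact h5

end RegularDomain

/-- The function-induced form `g_θ(u, v) = (1/n) ⟨DΦ_X(θ) u, DΦ_X(θ) v⟩`. -/
def functionForm (σ : Activation p) (X : Fin n → Fin d → ℝ) (θ : Param m d) :
    LinearMap.BilinForm ℝ (Param m d) :=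
  LinearMap.mk₂ ℝ (fun u v => (1 / (n : ℝ)) *
      (fderiv ℝ (realization σ X) θ u ⬝ᵥ fderiv ℝ (realization σ X) θ v))
    (fun u u' v => by simp [mul_add]) (fun c u v => by simp [mul_left_comm])
    (fun u v v' => by simp [mul_add]) (fun c u v => by simp [mul_left_comm])

/-- The Euclidean inner product of `Θ = (ℝ × ℝᵈ)ᵐ`. -/
def euclideanForm (m d : ℕ) : LinearMap.BilinForm ℝ (Param m d) :=
  LinearMap.mk₂ ℝ (fun u v => ∑ i, ((u i).1 * (v i).1 + (u i).2 ⬝ᵥ (v i).2))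
    (fun u u' v => by
      rw [← Finset.sum_add_distrib]
      refine Finset.sum_congr rfl fun i _ => ?_
      simp
      ring)
    (fun c u v => by
      rw [Finset.smul_sum]
      refine Finset.sum_congr rfl fun i _ => ?_
      simp
      ring)
    (fun u v v' => by
      rw [← Finset.sum_add_distrib]
      refine Finset.sum_congr rfl fun i _ => ?_
      simp
      ring)
    (fun c u v => by
      rw [Finset.smul_sum]
      refine Finset.sum_congr rfl fun i _ => ?_
      simp
      ring)

/-- The horizontal space `H_θ`, the Euclidean orthogonal complement of `T_θ(G·θ)`. -/
def horizontalSpace (p : ℝ) (θ : Param m d) : Submodule ℝ (Param m d) :=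
  (euclideanForm m d).orthogonal (orbitTangent p θ)

theorem isCompl_horizontalSpace (p : ℝ) (θ : Param m d) :
    IsCompl (orbitTangent p θ) (horizontalSpace p θ) := by
  have hsymm : ∀ u v, euclideanForm m d u v = euclideanForm m d v u := by
    intro u v
    change ∑ i, ((u i).1 * (v i).1 + (u i).2 ⬝ᵥ (v i).2) =
      ∑ i, ((v i).1 * (u i).1 + (v i).2 ⬝ᵥ (u i).2)
    refine Finset.sum_congr rfl fun i _ => ?_
    rw [mul_comm, dotProduct_comm]
  refine (LinearMap.BilinForm.isCompl_orthogonal_iff_disjoint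
    (fun u v h => by rw [hsymm, h])).2 ?_
  rw [Submodule.disjoint_def]
  intro u hu hu'
  have h0 : ∑ i, ((u i).1 * (u i).1 + (u i).2 ⬝ᵥ (u i).2) = 0 := hu' u hu
  have hnn : ∀ i ∈ Finset.univ, 0 ≤ (u i).1 * (u i).1 + (u i).2 ⬝ᵥ (u i).2 := fun i _ =>
    add_nonneg (mul_self_nonneg _) (Finset.sum_nonneg fun j _ => mul_self_nonneg _)
  funext i
  have h1 := (Finset.sum_eq_zero_iff_of_nonneg hnn).1 h0 i (Finset.mem_univ i)
  have h2 : 0 ≤ (u i).2 ⬝ᵥ (u i).2 := Finset.sum_nonneg fun j _ => mul_self_nonneg _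
  have h3 : (u i).1 * (u i).1 = 0 := by nlinarith [mul_self_nonneg (u i).1]
  have h4 : (u i).2 ⬝ᵥ (u i).2 = 0 := by linarith
  exact Prod.ext (mul_self_eq_zero.1 h3) (dotProduct_self_eq_zero.1 h4)

namespace RegularDomain

variable {R : RegularDomain m σ X}

theorem hasMFDerivAt_val (θ : R.carrier) :
    HasMFDerivAt 𝓘(ℝ, Param m d) 𝓘(ℝ, Param m d) (Subtype.val : R.carrier → Param m d) θ
      (ContinuousLinearMap.id ℝ (Param m d)) := by
  refine ⟨continuous_subtype_val.continuousAt, ?_⟩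
  have h : writtenInExtChartAt 𝓘(ℝ, Param m d) 𝓘(ℝ, Param m d) θ
      (Subtype.val : R.carrier → Param m d) =ᶠ[𝓝 (θ : Param m d)] id := by
    filter_upwards [R.carrier.isOpen.mem_nhds θ.2] with y hy
    have hy' : y ∈ (chartAt (Param m d) θ).target := by
      have := (chartAt (Param m d) θ).map_source (x := (⟨y, hy⟩ : R.carrier)) (by
        simp [TopologicalSpace.Opens.chartAt_eq, chartAt_self_eq])
      simpa [TopologicalSpace.Opens.chartAt_eq, chartAt_self_eq] using this
    have := (chartAt (Param m d) θ).right_inv hy'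
    simpa [writtenInExtChartAt, TopologicalSpace.Opens.chartAt_eq] using this
  exact ((hasFDerivAt_id (θ : Param m d)).congr_of_eventuallyEq h).hasFDerivWithinAt

theorem realization_eq_of_proj_eq {θ θ' : R.carrier} (h : R.proj θ = R.proj θ') :
    realization σ X (θ : Param m d) = realization σ X (θ' : Param m d) := by
  obtain ⟨g, rfl⟩ := proj_eq_iff.1 h
  exact realization_smul σ X g θ'

/-- `ker Dq_θ = T_θ(G·θ)`. -/
theorem ker_projDeriv (θ : R.carrier) (u : Param m d) :
    projDeriv θ u = 0 ↔ u ∈ orbitTangent p (θ : Param m d) := by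
  have hle : LinearMap.ker (projDeriv θ).toLinearMap ≤ orbitTangent p (θ : Param m d) := by
    intro u hu
    have hu0 : projDeriv θ u = 0 := hu
    rw [← (R.regular θ θ.2).ker_eq]
    obtain ⟨s, hs1, hs2, hs3⟩ := exists_local_section θ
    have hΦ : MDifferentiableAt 𝓘(ℝ, Param m d) 𝓘(ℝ, Fin n → ℝ) (realization σ X)
        (θ : Param m d) :=
      ((R.regular θ θ.2).smooth.differentiableAt (by simp)).mdifferentiableAt
    have h1 : HasMFDerivAt 𝓘(ℝ, Param m d) 𝓘(ℝ, Fin n → ℝ)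
        (fun θ' : R.carrier => realization σ X (θ' : Param m d)) θ
        (fderiv ℝ (realization σ X) (θ : Param m d)) := by
      have h2 := hΦ.hasMFDerivAt
      rw [mfderiv_eq_fderiv] at h2
      exact h2.comp θ (hasMFDerivAt_val θ)
    have h3 : MDifferentiableAt 𝓘(ℝ, Model m d) 𝓘(ℝ, Fin n → ℝ)
        (fun x => realization σ X (s x : Param m d)) (R.proj θ) := by
      refine MDifferentiableAt.comp (R.proj θ)
        (g := fun θ' : R.carrier => realization σ X (θ' : Param m d)) ?_
        (hs2.mdifferentiableAt (by simp))
      rw [hs1]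
      exact h1.mdifferentiableAt
    have h4 := h3.hasMFDerivAt.comp θ ((contMDiffAt_proj θ).mdifferentiableAt (by simp)).hasMFDerivAt
    have h5 : ((fun x => realization σ X (s x : Param m d)) ∘ R.proj) =ᶠ[𝓝 θ]
        (fun θ' : R.carrier => realization σ X (θ' : Param m d)) := by
      have hc : ContinuousAt R.proj θ := isOpenQuotientMap_proj.continuous.continuousAt
      filter_upwards [hc.eventually hs3] with θ' hθ'
      exact realization_eq_of_proj_eq hθ'
    have h6 := hasMFDerivAt_unique h1 (h4.congr_of_eventuallyEq h5.symm)
    have h7 := DFunLike.congr_fun h6 u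
    refine h7.trans ?_
    change (mfderiv 𝓘(ℝ, Model m d) 𝓘(ℝ, Fin n → ℝ)
        (fun x => realization σ X (s x : Param m d)) (R.proj θ)) (projDeriv θ u) = 0
    rw [hu0, map_zero]
  have hfr : Module.finrank ℝ (LinearMap.ker (projDeriv θ).toLinearMap) =
      Module.finrank ℝ (orbitTangent p (θ : Param m d)) := by
    have h1 := LinearMap.finrank_range_add_finrank_ker (projDeriv θ).toLinearMap
    have h2 : LinearMap.range (projDeriv θ).toLinearMap = ⊤ :=
      LinearMap.range_eq_top.2 (projDeriv_surjective θ)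
    rw [h2, finrank_top, finrank_tan, finrank_param] at h1
    rw [(R.regular θ θ.2).finrank_orbitTangent]
    omega
  rw [← Submodule.eq_of_le_of_finrank_eq hle hfr]
  rfl

/-- The isomorphism `Dq_θ : H_θ ≃ T_{[θ]} M_reg`. -/
def horizontalEquiv (θ : R.carrier) :
    horizontalSpace p (θ : Param m d) ≃ₗ[ℝ] Tan (R.proj θ) :=
  LinearEquiv.ofBijective ((projDeriv θ).toLinearMap ∘ₗ (horizontalSpace p (θ : Param m d)).subtype)
    (by
      have hc := isCompl_horizontalSpace p (θ : Param m d)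
      constructor
      · rw [← LinearMap.ker_eq_bot, LinearMap.ker_eq_bot']
        intro u hu
        exact Subtype.ext (Submodule.disjoint_def.1 hc.disjoint u ((ker_projDeriv θ u).1 hu) u.2)
      · intro ξ
        obtain ⟨u, rfl⟩ := projDeriv_surjective θ ξ
        obtain ⟨v, w, h⟩ := Submodule.codisjoint_iff_exists_add_eq.1 hc.codisjoint u
        refine ⟨⟨w, h.2.1⟩, ?_⟩
        change projDeriv θ w = projDeriv θ u
        rw [← h.2.2, map_add, (ker_projDeriv θ v).2 h.1, zero_add])

/-- The horizontal lift of a tangent vector at `[θ]` to `θ`. -/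
def horizontalLift (θ : R.carrier) : Tan (R.proj θ) →ₗ[ℝ] Param m d :=
  (horizontalSpace p (θ : Param m d)).subtype ∘ₗ (horizontalEquiv θ).symm.toLinearMap

theorem projDeriv_horizontalLift (θ : R.carrier) (ξ : Tan (R.proj θ)) :
    projDeriv θ (horizontalLift θ ξ) = ξ :=
  (horizontalEquiv θ).apply_symm_apply ξ

/-- The form `(ξ, η) ↦ g_θ(ξ^hor, η^hor)` on `T_{[θ]} M_reg`, computed at the representative `θ`. -/
def liftedForm (θ : R.carrier) : LinearMap.BilinForm ℝ (Tan (R.proj θ)) :=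
  (functionForm σ X (θ : Param m d)).compl₁₂ (horizontalLift θ) (horizontalLift θ)

/-- A representative of a point of the quotient. -/
def rep (x : R.Moduli) : R.carrier := Function.surjInv proj_surjective x

theorem proj_rep (x : R.Moduli) : R.proj (rep x) = x := Function.surjInv_eq proj_surjective x

/-- The quotient metric `ḡ`: `ḡ_{[θ]}(Dq_θ u, Dq_θ v) = g_θ(u, v)`. -/
def quotientMetric (x : R.Moduli) : LinearMap.BilinForm ℝ (Tan x) :=
  proj_rep x ▸ liftedForm (rep x)

theorem liftedForm_projDeriv (θ : R.carrier) (u v : Param m d) :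
    liftedForm θ (projDeriv θ u) (projDeriv θ v) = functionForm σ X (θ : Param m d) u v := by
  have key : ∀ w : Param m d, fderiv ℝ (realization σ X) θ (horizontalLift θ (projDeriv θ w)) =
      fderiv ℝ (realization σ X) θ w := by
    intro w
    rw [← sub_eq_zero, ← map_sub, (R.regular θ θ.2).ker_eq, ← ker_projDeriv, map_sub,
      projDeriv_horizontalLift, sub_self]
  change (1 / (n : ℝ)) * (_ ⬝ᵥ _) = (1 / (n : ℝ)) * (_ ⬝ᵥ _)
  rw [key, key]

theorem quotientMetric_pos (x : R.Moduli) (ξ : Tan x) (hξ : ξ ≠ 0) :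
    0 < quotientMetric x ξ ξ := by
  have key : ∀ (θ : R.carrier) (h : R.proj θ = x),
      0 < (h ▸ liftedForm θ : LinearMap.BilinForm ℝ (Tan x)) ξ ξ := by
    rintro θ rfl
    obtain ⟨u, rfl⟩ := projDeriv_surjective θ ξ
    change 0 < liftedForm θ (projDeriv θ u) (projDeriv θ u)
    rw [liftedForm_projDeriv]
    have hu : fderiv ℝ (realization σ X) θ u ≠ 0 := by
      intro h
      exact hξ ((ker_projDeriv θ u).2 ((R.regular θ θ.2).ker_eq u |>.1 h))
    have hn : 0 < n := by
      rcases Nat.eq_zero_or_pos n with rfl | h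
      · exact absurd (Subsingleton.elim _ _) hu
      · exact h
    have h2 : 0 < fderiv ℝ (realization σ X) θ u ⬝ᵥ fderiv ℝ (realization σ X) θ u := by
      refine lt_of_le_of_ne (Finset.sum_nonneg fun j _ => mul_self_nonneg _) ?_
      exact fun h => hu (dotProduct_self_eq_zero.1 h.symm)
    change 0 < (1 / (n : ℝ)) * _
    positivity
  exact key (rep x) (proj_rep x)

theorem quotientMetric_nondegenerate (x : R.Moduli) : (quotientMetric x).Nondegenerate := by
  constructor
  · intro ξ h
    by_contra hne
    exact (quotientMetric_pos x ξ hne).ne' (h ξ)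
  · intro ξ h
    by_contra hne
    exact (quotientMetric_pos x ξ hne).ne' (h ξ)

end RegularDomain

namespace RegularDomain

variable {R : RegularDomain m σ X}

/-- The defining property of the quotient metric, at every representative. -/
theorem quotientMetric_projDeriv (θ : R.carrier) (u v : Param m d) :
    quotientMetric (R.proj θ) (projDeriv θ u) (projDeriv θ v) =
      functionForm σ X (θ : Param m d) u v := by
  have cast : ∀ (x y : R.Moduli) (h : x = y) (B : LinearMap.BilinForm ℝ (Tan x))
      (ξ η : Model m d), (h ▸ B : LinearMap.BilinForm ℝ (Tan y)) (show Tan y from ξ)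
        (show Tan y from η) = B (show Tan x from ξ) (show Tan x from η) := by
    rintro x y rfl B ξ η
    rfl
  obtain ⟨g, hg⟩ := proj_eq_iff.1 (proj_rep (R.proj θ)).symm
  have hval : actionL g (rep (R.proj θ) : Param m d) = θ := congrArg Subtype.val hg
  have hinv : ∀ w : Param m d, fderiv ℝ (realization σ X) (rep (R.proj θ) : Param m d) w =
      fderiv ℝ (realization σ X) (θ : Param m d) (actionL g w) := by
    intro w
    have h1 : HasFDerivAt (realization σ X) (fderiv ℝ (realization σ X) (θ : Param m d))
        (actionL g (rep (R.proj θ) : Param m d)) := by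
      rw [hval]
      exact ((R.regular θ θ.2).smooth.differentiableAt (by simp)).hasFDerivAt
    have h2 := h1.comp (rep (R.proj θ) : Param m d) (actionL g).hasFDerivAt
    have h3 : (realization σ X) ∘ (actionL g : Param m d → Param m d) = realization σ X :=
      funext fun θ' => realization_smul σ X g θ'
    rw [h3] at h2
    rw [h2.fderiv]
    rfl
  have hproj : ∀ w : Param m d, (show Model m d from projDeriv (rep (R.proj θ)) w) =
      projDeriv θ (actionL g w) := by
    intro w
    have hact : HasMFDerivAt 𝓘(ℝ, Param m d) 𝓘(ℝ, Param m d)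
        (fun θ' : R.carrier => g • θ') (rep (R.proj θ)) (actionL g) := by
      have h1 := ((contMDiffAt_smul g (rep (R.proj θ))).mdifferentiableAt
        (by simp)).hasMFDerivAt
      have h2 := (hasMFDerivAt_val (g • rep (R.proj θ))).comp (rep (R.proj θ)) h1
      have h3 : HasMFDerivAt 𝓘(ℝ, Param m d) 𝓘(ℝ, Param m d)
          (fun θ' : R.carrier => g • (θ' : Param m d)) (rep (R.proj θ)) (actionL g) :=
        ((actionL g).hasMFDerivAt (x := (rep (R.proj θ) : Param m d))).comp (rep (R.proj θ))
          (hasMFDerivAt_val (rep (R.proj θ)))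
      have h4 := hasMFDerivAt_unique h2 h3
      have h5 : mfderiv 𝓘(ℝ, Param m d) 𝓘(ℝ, Param m d)
        (fun θ' : R.carrier => g • θ') (rep (R.proj θ)) = actionL g := h4
      rw [h5] at h1
      exact h1
    have hp : HasMFDerivAt 𝓘(ℝ, Param m d) 𝓘(ℝ, Model m d) R.proj (g • rep (R.proj θ))
        (projDeriv (g • rep (R.proj θ))) :=
      ((contMDiffAt_proj _).mdifferentiableAt (by simp)).hasMFDerivAt
    have hc := hp.comp (rep (R.proj θ)) hact
    have hcomp : (R.proj ∘ fun θ' : R.carrier => g • θ') = R.proj :=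
      funext fun θ' => proj_smul g θ'
    rw [hcomp] at hc
    have hu := hc.mfderiv
    have h6 : ∀ θ₁ θ₂ : R.carrier, θ₁ = θ₂ → ∀ w : Param m d,
        (show Model m d from projDeriv θ₁ w) = projDeriv θ₂ w := by
      rintro θ₁ _ rfl w
      rfl
    rw [← h6 _ _ hg (actionL g w)]
    exact DFunLike.congr_fun hu w
  obtain ⟨u', rfl⟩ : ∃ u', actionL g u' = u := ⟨g⁻¹ • u, smul_inv_smul g u⟩
  obtain ⟨v', rfl⟩ : ∃ v', actionL g v' = v := ⟨g⁻¹ • v, smul_inv_smul g v⟩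
  have e1 := cast _ _ (proj_rep (R.proj θ)) (liftedForm (rep (R.proj θ)))
    (projDeriv θ (actionL g u')) (projDeriv θ (actionL g v'))
  refine e1.trans ?_
  rw [← hproj, ← hproj]
  refine (liftedForm_projDeriv (rep (R.proj θ)) u' v').trans ?_
  change (1 / (n : ℝ)) * (_ ⬝ᵥ _) = (1 / (n : ℝ)) * (_ ⬝ᵥ _)
  rw [hinv, hinv]

end RegularDomain

/-- The loss `L(θ) = L̃(Φ_X(θ))`. -/
def loss (σ : Activation p) (X : Fin n → Fin d → ℝ) (Lt : (Fin n → ℝ) → ℝ) (θ : Param m d) : ℝ :=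
  Lt (realization σ X θ)

namespace RegularDomain

variable (R : RegularDomain m σ X)

/-- The descended loss `L̄ : M_reg → ℝ`, `L̄([θ]) = L(θ)`. -/
def descendedLoss (Lt : (Fin n → ℝ) → ℝ) (x : R.Moduli) : ℝ :=
  Quotient.lift (s := MulAction.orbitRel (SymGroup m p) R.carrier)
    (fun θ => loss σ X Lt (θ : Param m d))
    (fun _ _ h => congrArg Lt (realization_eq_of_proj_eq (Quotient.sound h))) x

/-- The gradient `grad_ḡ f` of a function on `M_reg`: `ḡ(grad_ḡ f, ξ) = Df[ξ]` for all `ξ`. -/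
def gradient (f : R.Moduli → ℝ) (x : R.Moduli) : Tan x :=
  ((quotientMetric x).toDual (quotientMetric_nondegenerate x)).symm
    (mvfderiv 𝓘(ℝ, Model m d) f x).toLinearMap

/-- The differential at `x` of the preferred chart around `x`. -/
def chartDeriv (x : R.Moduli) : Tan x →L[ℝ] Model m d :=
  mfderiv 𝓘(ℝ, Model m d) 𝓘(ℝ, Model m d) (chartAt (Model m d) x) x

/-- The coefficients of `ḡ` in the preferred chart `φ` around `x`: at `z`, this is the pullback
of `ḡ` by `φ⁻¹`. -/
def coordMetric (x : R.Moduli) (z : Model m d) : Model m d →L[ℝ] Model m d →L[ℝ] ℝ :=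
  LinearMap.toContinuousLinearMap (LinearMap.toContinuousLinearMap.toLinearMap ∘ₗ
    (quotientMetric ((chartAt (Model m d) x).symm z)).compl₁₂
      (mfderiv 𝓘(ℝ, Model m d) 𝓘(ℝ, Model m d) (chartAt (Model m d) x).symm z).toLinearMap
      (mfderiv 𝓘(ℝ, Model m d) 𝓘(ℝ, Model m d) (chartAt (Model m d) x).symm z).toLinearMap)

/-- The derivative at `φ(x)` of the coefficients of `ḡ` in the preferred chart `φ` around `x`. -/
def coordMetricDeriv (x : R.Moduli) :
    Model m d →L[ℝ] Model m d →L[ℝ] Model m d →L[ℝ] ℝ :=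
  fderiv ℝ (R.coordMetric x) (chartAt (Model m d) x x)

/-- The Christoffel symbols of the first kind of `ḡ` in the preferred chart around `x`,
`½ (∂_ξ ḡ(η, ζ) + ∂_η ḡ(ξ, ζ) - ∂_ζ ḡ(ξ, η))`, as a linear form in `ζ`. -/
def christoffelForm (x : R.Moduli) (ξ η : Tan x) : Module.Dual ℝ (Tan x) where
  toFun ζ := (1 / 2 : ℝ) *
    (R.coordMetricDeriv x (R.chartDeriv x ξ) (R.chartDeriv x η) (R.chartDeriv x ζ) +
      R.coordMetricDeriv x (R.chartDeriv x η) (R.chartDeriv x ξ) (R.chartDeriv x ζ) -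
      R.coordMetricDeriv x (R.chartDeriv x ζ) (R.chartDeriv x ξ) (R.chartDeriv x η))
  map_add' ζ ζ' := by
    simp
    ring
  map_smul' c ζ := by
    simp
    ring

/-- The Levi-Civita connection of `ḡ` at `x` applied to the vector fields with constant
coefficients `ξ`, `η` in the preferred chart around `x`: the vector `Γ(ξ, η)` with
`ḡ(Γ(ξ, η), ζ) = ½ (∂_ξ ḡ(η, ζ) + ∂_η ḡ(ξ, ζ) - ∂_ζ ḡ(ξ, η))`. -/
def christoffel (x : R.Moduli) (ξ η : Tan x) : Tan x :=
  ((quotientMetric x).toDual (quotientMetric_nondegenerate x)).symm (R.christoffelForm x ξ η)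

/-- The Riemannian Hessian `Hess_ḡ f (ξ, η) = ξ(η f) - (∇_ξ η) f` of a function on `M_reg`,
where `ξ`, `η` are extended with constant coefficients in the preferred chart `φ` around `x`: in
coordinates, `∂ᵢ∂ⱼ f - Γᵏᵢⱼ ∂ₖ f`. -/
def hessian (f : R.Moduli → ℝ) (x : R.Moduli) : LinearMap.BilinForm ℝ (Tan x) :=
  LinearMap.mk₂ ℝ
    (fun ξ η =>
      fderiv ℝ (fderiv ℝ (f ∘ (chartAt (Model m d) x).symm)) (chartAt (Model m d) x x)
        (R.chartDeriv x ξ) (R.chartDeriv x η) -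
      mvfderiv 𝓘(ℝ, Model m d) f x (R.christoffel x ξ η))
    (fun ξ ξ' η => by
      have h : R.christoffelForm x (ξ + ξ') η =
          R.christoffelForm x ξ η + R.christoffelForm x ξ' η := by
        ext ζ
        simp [christoffelForm]
        ring
      simp only [christoffel, h, map_add, add_apply]
      ring)
    (fun c ξ η => by
      have h : R.christoffelForm x (c • ξ) η = c • R.christoffelForm x ξ η := by
        ext ζ
        simp [christoffelForm]
        ring
      simp only [christoffel, h, map_smul, _root_.smul_apply, smul_eq_mul]
      ring)
    (fun ξ η η' => by
      have h : R.christoffelForm x ξ (η + η') =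
          R.christoffelForm x ξ η + R.christoffelForm x ξ η' := by
        ext ζ
        simp [christoffelForm]
        ring
      simp only [christoffel, h, map_add]
      ring)
    (fun c ξ η => by
      have h : R.christoffelForm x ξ (c • η) = c • R.christoffelForm x ξ η := by
        ext ζ
        simp [christoffelForm]
        ring
      simp only [christoffel, h, map_smul, smul_eq_mul]
      ring)

/-- The effective Hessian `H^eff_x : T_x M_reg → T_x M_reg`, the operator with
`ḡ_x(H^eff ξ, η) = Hess_ḡ L̄(x)(ξ, η)` for all `ξ`, `η`. -/
def effectiveHessian (Lt : (Fin n → ℝ) → ℝ) (x : R.Moduli) : Tan x →ₗ[ℝ] Tan x :=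
  ((quotientMetric x).toDual (quotientMetric_nondegenerate x)).symm.toLinearMap ∘ₗ
    R.hessian (R.descendedLoss Lt) x

end RegularDomain

end ShallowNet

end

/-! The argument takes place on the quotient and is then carried upstairs. The form `quotientMetric`
is positive definite because the kernel of the differential of the realization map is exactly the
kernel of the differential of `proj`. It is therefore nondegenerate, and raising an index is an
isomorphism. Hence the effective Hessian and the Riemannian Hessian have the same quadratic form
(`quotientMetric_effectiveHessian`), and a vanishing gradient means a vanishing differential
(`mvfderiv_eq_zero_of_gradient_eq_zero`).

At a critical point the Christoffel term of the Riemannian Hessian is the differential applied to a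
vector, so it drops out. What remains is the ordinary second derivative in a chart
(`hessian_apply_of_mvfderiv_eq_zero`). The descended loss is smooth in the chart because the
quotient map has smooth local sections, so the second derivative test of calculus yields a strict
local minimum (`descendedLoss_eventually_lt`).

The fibres of the quotient map are exactly the orbits in the regular domain, and the loss is
constant on them. Pulling back a neighbourhood of the strict minimum therefore gives minimality
upstairs, with equality precisely on the orbit (`exists_isOpen_loss_le`).

Degeneracy upstairs is compatible with this. Every point of the orbit is a local minimizer, so the
differential of the loss vanishes along the whole orbit, and differentiating this identity along a
curve in the orbit kills the second derivative in orbit directions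
(`fderiv_fderiv_eq_zero_of_mem_orbitTangent`). Those directions are invisible on the quotient, being
the kernel of the differential of `proj`. They span a space of dimension `m` because local freeness
makes `orbitVector` injective. -/

/-! ### Second derivative test in a finite-dimensional normed space -/

/-- The second derivative test: a critical point at which the second derivative is positive
definite is a strict local minimizer. -/
theorem eventually_lt_of_fderiv_fderiv_pos {E : Type*} [NormedAddCommGroup E] [NormedSpace ℝ E]
    [FiniteDimensional ℝ E] {f : E → ℝ} {z : E} (hf : ContDiffAt ℝ 2 f z)
    (h0 : fderiv ℝ f z = 0) (hpos : ∀ v, v ≠ 0 → 0 < fderiv ℝ (fderiv ℝ f) z v v) :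
    ∀ᶠ y in 𝓝[≠] z, f z < f y := by
  have hsphere : ∀ᶠ y in 𝓝 z, ∀ v ∈ Metric.sphere (0 : E) 1,
      0 < fderiv ℝ (fderiv ℝ f) y v v := by
    -- Tube lemma: joint continuity of the quadratic form in base point and direction, together with
    -- compactness of the unit sphere, gives one neighbourhood of `z` that serves all unit
    -- directions.
    refine (isCompact_sphere (0 : E) 1).eventually_forall_of_forall_eventually fun v hv => ?_
    have hc : ContinuousAt (fderiv ℝ (fderiv ℝ f)) z :=
      ((hf.fderiv_right (m := 1) (by norm_num)).fderiv_right (m := 0) (by norm_num)).continuousAt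
    have hc' : ContinuousAt (fun q : E × E => fderiv ℝ (fderiv ℝ f) q.1 q.2 q.2) (z, v) :=
      ((hc.comp (x := (z, v)) continuousAt_fst).clm_apply continuousAt_snd).clm_apply
        continuousAt_snd
    exact hc'.eventually (lt_mem_nhds (hpos v (ne_zero_of_mem_unit_sphere ⟨v, hv⟩)))
  have hposnear : ∀ᶠ y in 𝓝 z, ContDiffAt ℝ 2 f y ∧
      ∀ v, v ≠ 0 → 0 < fderiv ℝ (fderiv ℝ f) y v v := by
    filter_upwards [hsphere, hf.eventually (by simp)] with y hy hfy
    refine ⟨hfy, fun v hv => ?_⟩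
    have hn : 0 < ‖v‖ := norm_pos_iff.2 hv
    -- Normalizing `v` costs a factor `‖v‖⁻¹` in each argument; both are positive and are cancelled
    -- in turn.
    have h1 := hy (‖v‖⁻¹ • v) (by simp [norm_smul, hn.ne'])
    simp only [map_smul, smul_apply, smul_eq_mul] at h1
    have h2 : 0 < ‖v‖⁻¹ := inv_pos.2 hn
    exact pos_of_mul_pos_right (pos_of_mul_pos_right h1 h2.le) h2.le
  obtain ⟨ε, hε, hball⟩ := Metric.eventually_nhds_iff_ball.1 hposnear
  filter_upwards [nhdsWithin_le_nhds (Metric.ball_mem_nhds z hε), self_mem_nhdsWithin] with y hy hyz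
  have hv : y - z ≠ 0 := sub_ne_zero.2 hyz
  -- Balls are convex, so positivity of the second derivative is available on the whole segment from
  -- `z` to `y`, and the problem becomes one-dimensional.
  have hline : ∀ t ∈ Icc (0 : ℝ) 1, z + t • (y - z) ∈ Metric.ball z ε := fun t ht =>
    (convex_ball z ε).add_smul_sub_mem (Metric.mem_ball_self hε) hy ht
  have hl : ∀ t : ℝ, HasDerivAt (fun t : ℝ => z + t • (y - z)) (y - z) t := fun t => by
    simpa using ((hasDerivAt_id t).smul_const (y - z)).const_add z
  have hd1 : ∀ t ∈ Icc (0 : ℝ) 1, HasDerivAt (fun t : ℝ => f (z + t • (y - z)))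
      (fderiv ℝ f (z + t • (y - z)) (y - z)) t := fun t ht =>
    ((hball _ (hline t ht)).1.differentiableAt (by simp)).hasFDerivAt.comp_hasDerivAt t (hl t)
  have hd2 : ∀ t ∈ Icc (0 : ℝ) 1, HasDerivAt
      (fun t : ℝ => fderiv ℝ f (z + t • (y - z)) (y - z))
      (fderiv ℝ (fderiv ℝ f) (z + t • (y - z)) (y - z) (y - z)) t := fun t ht => by
    have h1 : DifferentiableAt ℝ (fderiv ℝ f) (z + t • (y - z)) :=
      ((hball _ (hline t ht)).1.fderiv_right (m := 1) (by norm_num)).differentiableAt (by simp)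
    exact (ContinuousLinearMap.apply ℝ ℝ (y - z)).hasFDerivAt.comp_hasDerivAt t
      (h1.hasFDerivAt.comp_hasDerivAt t (hl t))
  have hm2 : StrictMonoOn (fun t : ℝ => fderiv ℝ f (z + t • (y - z)) (y - z)) (Icc 0 1) := by
    refine strictMonoOn_of_deriv_pos (convex_Icc 0 1)
      (fun t ht => (hd2 t ht).continuousAt.continuousWithinAt) fun t ht => ?_
    rw [interior_Icc] at ht
    have ht' := Ioo_subset_Icc_self ht
    rw [(hd2 t ht').deriv]
    exact (hball _ (hline t ht')).2 _ hv
  have hm1 : StrictMonoOn (fun t : ℝ => f (z + t • (y - z))) (Icc 0 1) := by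
    refine strictMonoOn_of_deriv_pos (convex_Icc 0 1)
      (fun t ht => (hd1 t ht).continuousAt.continuousWithinAt) fun t ht => ?_
    rw [interior_Icc] at ht
    have ht' := Ioo_subset_Icc_self ht
    rw [(hd1 t ht').deriv]
    -- The directional derivative is strictly increasing and starts at `0` when `t = 0`, by
    -- criticality, so it is positive afterwards.
    simpa [h0] using hm2 (left_mem_Icc.2 zero_le_one) ht' ht.1
  simpa using hm1 (left_mem_Icc.2 zero_le_one) (right_mem_Icc.2 zero_le_one) zero_lt_one

namespace ShallowNet

variable {m d n : ℕ} {p : ℝ} {σ : Activation p} {X : Fin n → Fin d → ℝ}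

/-! ### The loss on parameters and curves in the orbits -/

theorem IsRegularPoint.contDiffAt_loss {θ : Param m d} (h : IsRegularPoint σ X θ)
    {Lt : (Fin n → ℝ) → ℝ} (hLt : ContDiff ℝ ∞ Lt) : ContDiffAt ℝ ∞ (loss σ X Lt) θ :=
  hLt.contDiffAt.comp θ h.smooth

theorem loss_smul (Lt : (Fin n → ℝ) → ℝ) (g : SymGroup m p) (θ : Param m d) :
    loss σ X Lt (g • θ) = loss σ X Lt θ :=
  congrArg Lt (realization_smul σ X g θ)

/-- With the transversal map `ι = 0` the slice map is the orbit map `t ↦ exp(t) · θ`, whose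
derivative at the origin is already known. This realizes every orbit tangent vector as the velocity
of a curve inside the orbit. -/
theorem hasDerivAt_expScale_smul (θ : Param m d) (ξ : Fin m → ℝ) :
    HasDerivAt (fun t : ℝ => expScale p (t • ξ) • θ) (orbitVector p θ ξ) 0 := by
  have h1 : HasFDerivAt (sliceMap p θ (0 : Model m d →L[ℝ] Param m d))
      (LinearMap.toContinuousLinearMap (orbitVector p θ) ∘L
        ContinuousLinearMap.fst ℝ (Fin m → ℝ) (Model m d)) ((0 : ℝ) • (ξ, (0 : Model m d))) := by
    rw [zero_smul]
    exact hasFDerivAt_sliceMap θ 0 _ fun ξ z => by simp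
  have h2 : HasDerivAt (fun t : ℝ => t • (ξ, (0 : Model m d))) (ξ, 0) 0 := by
    simpa using (hasDerivAt_id (0 : ℝ)).smul_const (ξ, (0 : Model m d))
  simpa [sliceMap, Function.comp_def] using h1.comp_hasDerivAt 0 h2

namespace RegularDomain

variable {R : RegularDomain m σ X}

/-! ### Critical points and Hessians on the quotient -/

theorem descendedLoss_proj (Lt : (Fin n → ℝ) → ℝ) (θ : R.carrier) :
    R.descendedLoss Lt (R.proj θ) = loss σ X Lt (θ : Param m d) := rfl

theorem quotientMetric_effectiveHessian (Lt : (Fin n → ℝ) → ℝ) (x : R.Moduli) (ξ η : Tan x) :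
    quotientMetric x (R.effectiveHessian Lt x ξ) η = R.hessian (R.descendedLoss Lt) x ξ η :=
  LinearMap.BilinForm.apply_toDual_symm_apply (hB := quotientMetric_nondegenerate x) _ _

/-- The gradient is the image of the differential under a linear isomorphism, the inverse of the one
from vectors to covectors given by the nondegenerate metric. -/
theorem mvfderiv_eq_zero_of_gradient_eq_zero {f : R.Moduli → ℝ} {x : R.Moduli}
    (h : R.gradient f x = 0) : mvfderiv 𝓘(ℝ, Model m d) f x = 0 := by
  have h1 := (LinearEquiv.map_eq_zero_iff _).1 h
  ext ξ
  exact DFunLike.congr_fun h1 ξ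

/-- Near the base point the inverse chart is `proj ∘ s` for a smooth local section `s`, so the
coordinate expression is the loss composed with `s`. Both are smooth, since `s` takes values in
regular points. -/
theorem contDiffAt_descendedLoss_comp_chart_symm {Lt : (Fin n → ℝ) → ℝ} (hLt : ContDiff ℝ ∞ Lt)
    (x : R.Moduli) : ContDiffAt ℝ ∞ (R.descendedLoss Lt ∘ (chartAt (Model m d) x).symm)
      (chartAt (Model m d) x x) := by
  obtain ⟨θ, rfl⟩ := proj_surjective x
  obtain ⟨s, hs1, hs2, hs3⟩ := (isQuotientChart_chartAt (R.proj θ)).exists_section θ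
    (mem_chart_source _ _)
  have h1 : ContMDiffAt 𝓘(ℝ, Model m d) 𝓘(ℝ, Param m d) ∞ (fun z => (s z : Param m d))
      (chartAt (Model m d) (R.proj θ) (R.proj θ)) :=
    contMDiff_subtype_val.contMDiffAt.comp _ hs2
  have h2 : ContDiffAt ℝ ∞ (loss σ X Lt)
      (s (chartAt (Model m d) (R.proj θ) (R.proj θ)) : Param m d) :=
    (R.regular _ (Subtype.prop _)).contDiffAt_loss hLt
  have h3 := ContDiffAt.comp (g := loss σ X Lt) (f := fun z => (s z : Param m d)) _ h2
    h1.contDiffAt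
  refine h3.congr_of_eventuallyEq ?_
  filter_upwards [hs3] with z hz
  rw [Function.comp_apply, ← hz]
  rfl

theorem chartDeriv_bijective (x : R.Moduli) : Function.Bijective (R.chartDeriv x) :=
  (mdifferentiable_chart (I := 𝓘(ℝ, Model m d)) x).mfderiv_bijective (mem_chart_source _ x)

/-- A critical point of `f` is a critical point of its coordinate expression. -/
theorem fderiv_comp_chart_symm_eq_zero {f : R.Moduli → ℝ} {x : R.Moduli}
    (hf : DifferentiableAt ℝ (f ∘ (chartAt (Model m d) x).symm) (chartAt (Model m d) x x))
    (h : mvfderiv 𝓘(ℝ, Model m d) f x = 0) :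
    fderiv ℝ (f ∘ (chartAt (Model m d) x).symm) (chartAt (Model m d) x x) = 0 := by
  have hφ : HasMFDerivAt 𝓘(ℝ, Model m d) 𝓘(ℝ, Model m d) (chartAt (Model m d) x) x
      (R.chartDeriv x) :=
    ((mdifferentiable_chart (I := 𝓘(ℝ, Model m d)) x).mdifferentiableAt
      (mem_chart_source _ x)).hasMFDerivAt
  have h1 := hf.hasFDerivAt.hasMFDerivAt.comp x hφ
  -- Near `x`, `f` is its coordinate expression composed with the chart. The chain rule then
  -- determines the coordinate differential on the range of `chartDeriv`, which is everything.
  have h2 : (f ∘ (chartAt (Model m d) x).symm) ∘ chartAt (Model m d) x =ᶠ[𝓝 x] f := by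
    filter_upwards [(chartAt (Model m d) x).open_source.mem_nhds (mem_chart_source _ x)] with y hy
    simp [(chartAt (Model m d) x).left_inv hy]
  have h3 := (h1.congr_of_eventuallyEq h2.symm).mfderiv
  ext v
  obtain ⟨ξ, rfl⟩ := (chartDeriv_bijective x).2 v
  have h4 := DFunLike.congr_fun h ξ
  have h5 := DFunLike.congr_fun h3 ξ
  exact h5.symm.trans h4

/-- At a critical point the Riemannian Hessian is the coordinate Hessian. -/
theorem hessian_apply_of_mvfderiv_eq_zero {f : R.Moduli → ℝ} {x : R.Moduli}
    (h : mvfderiv 𝓘(ℝ, Model m d) f x = 0) (ξ η : Tan x) :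
    R.hessian f x ξ η = fderiv ℝ (fderiv ℝ (f ∘ (chartAt (Model m d) x).symm))
      (chartAt (Model m d) x x) (R.chartDeriv x ξ) (R.chartDeriv x η) := by
  -- The connection enters only through the differential of `f` evaluated at the Christoffel vector.
  change _ - mvfderiv 𝓘(ℝ, Model m d) f x _ = _
  rw [h]
  exact sub_zero _

/-- At a critical point the coordinate Hessian is the Riemannian Hessian transported by the
bijection `chartDeriv`, so it is positive definite and the second derivative test applies in the
chart. -/
theorem descendedLoss_eventually_lt {Lt : (Fin n → ℝ) → ℝ} (hLt : ContDiff ℝ ∞ Lt) {x : R.Moduli}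
    (hcrit : R.gradient (R.descendedLoss Lt) x = 0)
    (hpos : ∀ ξ : Tan x, ξ ≠ 0 → 0 < R.hessian (R.descendedLoss Lt) x ξ ξ) :
    ∀ᶠ y in 𝓝[≠] x, R.descendedLoss Lt x < R.descendedLoss Lt y := by
  have hsm := contDiffAt_descendedLoss_comp_chart_symm hLt x
  have hmv := mvfderiv_eq_zero_of_gradient_eq_zero hcrit
  have hx := mem_chart_source (Model m d) x
  have h1 := eventually_lt_of_fderiv_fderiv_pos (contDiffAt_infty.1 hsm 2)
    (fderiv_comp_chart_symm_eq_zero (hsm.differentiableAt (by simp)) hmv) fun v hv => by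
      obtain ⟨ξ, rfl⟩ := (chartDeriv_bijective x).2 v
      have hξ : ξ ≠ 0 := by
        rintro rfl
        exact hv (map_zero _)
      rw [← hessian_apply_of_mvfderiv_eq_zero hmv]
      exact hpos ξ hξ
  rw [eventually_nhdsWithin_iff] at h1 ⊢
  filter_upwards [((chartAt (Model m d) x).continuousAt hx).eventually h1,
    (chartAt (Model m d) x).open_source.mem_nhds hx] with y hy hys hyx
  -- Injectivity of the chart on its source turns `y ≠ x` into distinct coordinates, as the
  -- punctured neighbourhood requires.
  have h2 := hy fun h => hyx ((chartAt (Model m d) x).injOn hys hx h)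
  simpa only [Function.comp_apply, (chartAt (Model m d) x).left_inv hx,
    (chartAt (Model m d) x).left_inv hys] using h2

/-! ### From the quotient back to the parameter space -/

/-- A strict minimum of the descended loss lifts to a minimum modulo the orbit. -/
theorem exists_isOpen_loss_le {Lt : (Fin n → ℝ) → ℝ} (θ : R.carrier)
    (h : ∀ᶠ y in 𝓝[≠] (R.proj θ), R.descendedLoss Lt (R.proj θ) < R.descendedLoss Lt y) :
    ∃ U : Set (Param m d), IsOpen U ∧ (θ : Param m d) ∈ U ∧ U ⊆ R.carrier ∧ ∀ θ' ∈ U,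
      loss σ X Lt (θ : Param m d) ≤ loss σ X Lt θ' ∧
      (loss σ X Lt θ' = loss σ X Lt (θ : Param m d) ↔
        θ' ∈ MulAction.orbit (SymGroup m p) (θ : Param m d)) := by
  obtain ⟨V, hV, hVo, hθV⟩ := mem_nhds_iff.1 (eventually_nhdsWithin_iff.1 h)
  -- The witness is the full preimage of `V`, viewed in `Param m d`; it is open there because the
  -- regular domain is open.
  refine ⟨Subtype.val '' (R.proj ⁻¹' V), ?_, ⟨θ, hθV, rfl⟩, ?_, ?_⟩
  · exact R.carrier.isOpen.isOpenMap_subtype_val _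
      (hVo.preimage isOpenQuotientMap_proj.continuous)
  · rintro _ ⟨θ', -, rfl⟩
    exact θ'.2
  · rintro _ ⟨θ', hθ', rfl⟩
    -- On the fibre over the minimum, invariance gives equality. Off it the inequality is strict,
    -- and membership in the orbit would force equal projections.
    by_cases hq : R.proj θ' = R.proj θ
    · obtain ⟨g, rfl⟩ := proj_eq_iff.1 hq
      have h1 : loss σ X Lt ((g • θ : R.carrier) : Param m d) = loss σ X Lt (θ : Param m d) :=
        loss_smul Lt g _
      exact ⟨h1.ge, iff_of_true h1 ⟨g, rfl⟩⟩
    · have h1 : loss σ X Lt (θ : Param m d) < loss σ X Lt (θ' : Param m d) := hV hθ' hq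
      refine ⟨h1.le, iff_of_false h1.ne' ?_⟩
      rintro ⟨g, hg⟩
      exact hq (proj_eq_iff.2 ⟨g, Subtype.ext hg⟩)

/-- If the differential of a smooth function vanishes along an orbit, its second derivative
vanishes in the orbit directions. -/
theorem fderiv_fderiv_eq_zero_of_mem_orbitTangent {f : Param m d → ℝ} {θ : Param m d}
    (hf : DifferentiableAt ℝ (fderiv ℝ f) θ) (h : ∀ g : SymGroup m p, fderiv ℝ f (g • θ) = 0)
    {u : Param m d} (hu : u ∈ orbitTangent p θ) : fderiv ℝ (fderiv ℝ f) θ u = 0 := by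
  obtain ⟨ξ, rfl⟩ := hu
  -- The base point is written as the value at `t = 0` of the orbit curve, so that the chain rule
  -- applies to `fderiv ℝ f` along it.
  have h1 : HasFDerivAt (fderiv ℝ f) (fderiv ℝ (fderiv ℝ f) θ)
      (expScale p ((0 : ℝ) • ξ) • θ) := by
    rw [zero_smul, expScale_zero_smul]
    exact hf.hasFDerivAt
  have h2 := h1.comp_hasDerivAt 0 (hasDerivAt_expScale_smul θ ξ)
  have h3 : (fderiv ℝ f ∘ fun t : ℝ => expScale p (t • ξ) • θ) = fun _ => 0 :=
    funext fun t => h _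
  rw [h3] at h2
  -- Along the curve `fderiv ℝ f` is constantly zero, so its derivative there, the second derivative
  -- applied to the orbit vector, is zero as a linear form.
  exact h2.unique (hasDerivAt_const 0 _)

/-! ### Linear algebra of positive definite Hessians -/

theorem hessian_nondegenerate_of_pos {f : R.Moduli → ℝ} {x : R.Moduli}
    (hpos : ∀ ξ : Tan x, ξ ≠ 0 → 0 < R.hessian f x ξ ξ) : (R.hessian f x).Nondegenerate := by
  constructor
  · intro ξ h
    by_contra hne
    exact (hpos ξ hne).ne' (h ξ)
  · intro ξ h
    by_contra hne
    exact (hpos ξ hne).ne' (h ξ)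

/-- A kernel vector would make the quadratic form vanish, so the operator is injective; the tangent
space is finite-dimensional, so it is also surjective. -/
theorem effectiveHessian_bijective_of_pos {Lt : (Fin n → ℝ) → ℝ} {x : R.Moduli}
    (hpos : ∀ ξ : Tan x, ξ ≠ 0 → 0 < quotientMetric x (R.effectiveHessian Lt x ξ) ξ) :
    Function.Bijective (R.effectiveHessian Lt x) := by
  have hinj : Function.Injective (R.effectiveHessian Lt x) := by
    rw [← LinearMap.ker_eq_bot, LinearMap.ker_eq_bot']
    intro ξ h
    by_contra hne
    have h1 := hpos ξ hne
    rw [h, map_zero] at h1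
    exact lt_irrefl _ h1
  exact ⟨hinj, LinearMap.injective_iff_surjective.1 hinj⟩

end RegularDomain

end ShallowNet

/-! ### The main theorem -/

theorem mainTheorem8 {m d n : ℕ} {p : ℝ} (σ : ShallowNet.Activation p)
    (X : Fin n → Fin d → ℝ) (R : ShallowNet.RegularDomain m σ X)
    (Lt : (Fin n → ℝ) → ℝ) (hLt : ContDiff ℝ ∞ Lt)
    (x : R.Moduli) (hcrit : R.gradient (R.descendedLoss Lt) x = 0) :
    ((∀ ξ : ShallowNet.RegularDomain.Tan x, ξ ≠ 0 →
        0 < ShallowNet.RegularDomain.quotientMetric x (R.effectiveHessian Lt x ξ) ξ) ↔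
      (∀ ξ : ShallowNet.RegularDomain.Tan x, ξ ≠ 0 →
        0 < R.hessian (R.descendedLoss Lt) x ξ ξ)) ∧
    ((∀ ξ : ShallowNet.RegularDomain.Tan x, ξ ≠ 0 →
        0 < ShallowNet.RegularDomain.quotientMetric x (R.effectiveHessian Lt x ξ) ξ) →
      ((R.hessian (R.descendedLoss Lt) x).Nondegenerate ∧
        Function.Bijective (R.effectiveHessian Lt x) ∧
        (∀ᶠ y in 𝓝[≠] x, R.descendedLoss Lt x < R.descendedLoss Lt y)) ∧
      ∀ θ : R.carrier, R.proj θ = x →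
        (∃ U : Set (ShallowNet.Param m d), IsOpen U ∧ (θ : ShallowNet.Param m d) ∈ U ∧
          U ⊆ R.carrier ∧ ∀ θ' ∈ U,
            ShallowNet.loss σ X Lt (θ : ShallowNet.Param m d) ≤ ShallowNet.loss σ X Lt θ' ∧
            (ShallowNet.loss σ X Lt θ' = ShallowNet.loss σ X Lt (θ : ShallowNet.Param m d) ↔
              θ' ∈ MulAction.orbit (ShallowNet.SymGroup m p) (θ : ShallowNet.Param m d))) ∧
        (∀ u ∈ ShallowNet.orbitTangent p (θ : ShallowNet.Param m d),
          ∀ v : ShallowNet.Param m d,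
            fderiv ℝ (fderiv ℝ (ShallowNet.loss σ X Lt)) (θ : ShallowNet.Param m d) u v = 0) ∧
        Module.finrank ℝ (ShallowNet.orbitTangent p (θ : ShallowNet.Param m d)) = m) := by

  have key := ShallowNet.RegularDomain.quotientMetric_effectiveHessian (R := R) Lt x
  refine ⟨by simp only [key], fun hpos => ?_⟩
  have hpos' : ∀ ξ : ShallowNet.RegularDomain.Tan x, ξ ≠ 0 →
      0 < R.hessian (R.descendedLoss Lt) x ξ ξ := by simpa only [key] using hpos
  have hmin := ShallowNet.RegularDomain.descendedLoss_eventually_lt hLt hcrit hpos'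
  refine ⟨⟨ShallowNet.RegularDomain.hessian_nondegenerate_of_pos hpos',
    ShallowNet.RegularDomain.effectiveHessian_bijective_of_pos hpos, hmin⟩, ?_⟩
  rintro θ rfl
  have hreg := R.regular θ θ.2
  refine ⟨ShallowNet.RegularDomain.exists_isOpen_loss_le θ hmin, fun u hu v => ?_,
    hreg.finrank_orbitTangent⟩
  -- Each `g • θ` represents the same point of the quotient, so the lifted minimality holds there
  -- too, and the differential of the loss vanishes at a local minimum.
  have hzero : ∀ g : ShallowNet.SymGroup m p,
      fderiv ℝ (ShallowNet.loss σ X Lt) (g • (θ : ShallowNet.Param m d)) = 0 := by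
    intro g
    obtain ⟨U, hUo, hgU, -, hU⟩ := ShallowNet.RegularDomain.exists_isOpen_loss_le (Lt := Lt) (g • θ)
      (by rwa [ShallowNet.RegularDomain.proj_smul])
    have hloc : IsLocalMin (ShallowNet.loss σ X Lt) (g • (θ : ShallowNet.Param m d)) := by
      filter_upwards [hUo.mem_nhds hgU] with θ' hθ'
      exact (hU θ' hθ').1
    exact hloc.fderiv_eq_zero
  have hdiff : DifferentiableAt ℝ (fderiv ℝ (ShallowNet.loss σ X Lt))
      (θ : ShallowNet.Param m d) :=
    ((contDiffAt_infty.1 (hreg.contDiffAt_loss hLt) 2).fderiv_right (m := 1) (by norm_num)).differentiableAt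
      (by simp)
  -- The second derivative applied to `u` is the zero functional, which disposes of every `v` at
  -- once.
  rw [ShallowNet.RegularDomain.fderiv_fderiv_eq_zero_of_mem_orbitTangent hdiff hzero hu]
  rfl
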